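/- An oriented graph is a directed graph without loops and multiple edges (at most one of the arcs $(u,v)$, $(v,u)$ for all vertices $u,v$). An oriented homomorphism from an oriented graph $G$ to an oriented graph $H$ is a map $\phi:V(G)\to V(H)$ such that $(\phi(u),\phi(v))$ is an arc of $H$ for every arc $(u,v)$ of $G$. The oriented chromatic number of an oriented graph $G$ is the least $k$ such that $G$ has an oriented homomorphism to an oriented graph with at most $k$ vertices, and the oriented chromatic number $\chi_o(G)$ of a simple graph $G$ is the maximum oriented chromatic number of its orientations. The Euler genus of a closed connected surface $S$ (orientable or not) is $2-n+e-f$, where $n,e,f$ are the numbers of vertices, edges and faces of a graph with a 2-cell embedding in $S$; the Euler genus of a finite graph $G$ is the least Euler genus of a closed surface in which $G$ embeds. For an integer $g\ge 0$ let $\chi_o(g)$ be the maximum of $\chi_o(G)$ over all finite simple graphs $G$ of Euler genus at most $g$. All logarithms are natural. Theorem. For every integer $g\ge 11$ this maximum $\chi_o(g)$ exists (is finite and attained) and $$\frac{\log(2)\,(g-1)}{\log(g-1)+\log(\log 2)-\log 2}\;\le\;\chi_o(g)\;\le\;2^{40}\,g\log g .$$ In particular, $\chi_o(g)=\Omega\!\left(\frac{g}{\log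 g}\right)$ and $\chi_o(g)=O(g\log g)$ as $g\to\infty$. -/

import Mathlib

namespace OrientedGenus

/-! ## Oriented graphs and oriented colouring -/

/-- An oriented graph: a directed graph without loops, without multiple edges, and with at most
one of the arcs `(u, v)`, `(v, u)` for every two vertices. (Asymmetry excludes loops.) -/
structure OrientedGraph (V : Type*) where
  /-- `Adj u v` says that `(u, v)` is an arc. -/
  Adj : V → V → Prop
  asymm : ∀ u v, Adj u v → ¬ Adj v u

/-- The underlying simple graph of an oriented graph. -/
def OrientedGraph.underlying {V : Type*} (D : OrientedGraph V) : SimpleGraph V where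
  Adj u v := D.Adj u v ∨ D.Adj v u
  symm := ⟨fun _ _ h => h.symm⟩
  loopless := ⟨fun v h => h.elim (fun h => D.asymm v v h h) (fun h => D.asymm v v h h)⟩

/-- `φ` is an oriented homomorphism from `D` to `H`. -/
def IsOrientedHom {V W : Type*} (D : OrientedGraph V) (H : OrientedGraph W) (φ : V → W) : Prop :=
  ∀ u v, D.Adj u v → H.Adj (φ u) (φ v)

/-- `D` is oriented `k`-colourable: it has an oriented homomorphism to an oriented graph with
at most `k` vertices. -/
def OrientedGraph.Colourable {V : Type*} (D : OrientedGraph V) (k : ℕ) : Prop :=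
  ∃ (m : ℕ) (H : OrientedGraph (Fin m)) (φ : V → Fin m), m ≤ k ∧ IsOrientedHom D H φ

/-- The oriented chromatic number of an oriented graph: the least `k` such that `D` is oriented
`k`-colourable (`⊤` if there is none, which does not happen for finite graphs). -/
noncomputable def OrientedGraph.chromaticNumber {V : Type*} (D : OrientedGraph V) : ℕ∞ :=
  ⨅ (k : ℕ) (_ : D.Colourable k), (k : ℕ∞)

/-- The oriented chromatic number of a simple graph: the maximum oriented chromatic number of
its orientations. -/
noncomputable def orientedChromaticNumber {V : Type*} (G : SimpleGraph V) : ℕ∞ :=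
  ⨆ (D : OrientedGraph V) (_ : D.underlying = G), D.chromaticNumber

/-! ## Surfaces and Euler genus -/

/-- A 2-cell embedding of a finite connected (multi)graph, with at least one edge, in a closed
surface (orientable or not), given by its flags.

The flags are the triangles of the barycentric subdivision of the cell decomposition: each has
one corner at a vertex, one at the midpoint of an edge, one at the centre of a face. Every flag
is glued along its three sides to three other flags: `τ₀ x`, `τ₁ x`, `τ₂ x` is the flag across
the side of `x` that is opposite to its vertex, edge, face corner, respectively. The surface is
closed, so the `τᵢ` are involutions without fixed points; exactly four flags `x`, `τ₀ x`, `τ₂ x`,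
`τ₀ (τ₂ x)` surround the midpoint of an edge; the surface is connected. Conversely, every such
gluing of finitely many triangles gives a 2-cell embedding in a closed surface. -/
structure CellEmbedding (F : Type*) where
  /-- change the vertex, keep the edge and the face -/
  τ₀ : F → F
  /-- change the edge, keep the vertex and the face -/
  τ₁ : F → F
  /-- change the face, keep the vertex and the edge -/
  τ₂ : F → F
  invol₀ : ∀ x, τ₀ (τ₀ x) = x
  invol₁ : ∀ x, τ₁ (τ₁ x) = x
  invol₂ : ∀ x, τ₂ (τ₂ x) = x
  ne₀ : ∀ x, τ₀ x ≠ x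
  ne₁ : ∀ x, τ₁ x ≠ x
  ne₂ : ∀ x, τ₂ x ≠ x
  comm : ∀ x, τ₀ (τ₂ x) = τ₂ (τ₀ x)
  ne₀₂ : ∀ x, τ₀ (τ₂ x) ≠ x
  nonempty : Nonempty F
  connected : ∀ x y, Relation.ReflTransGen (fun a b => b = τ₀ a ∨ b = τ₁ a ∨ b = τ₂ a) x y

namespace CellEmbedding

variable {F : Type*} (M : CellEmbedding F)

/-- The vertices: classes of flags under the equivalence generated by `τ₁` and `τ₂`. -/
def Vertex : Type _ := Quot (fun a b : F => b = M.τ₁ a ∨ b = M.τ₂ a)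

/-- The edges: classes of flags under the equivalence generated by `τ₀` and `τ₂`. -/
def Edge : Type _ := Quot (fun a b : F => b = M.τ₀ a ∨ b = M.τ₂ a)

/-- The faces: classes of flags under the equivalence generated by `τ₀` and `τ₁`. -/
def Face : Type _ := Quot (fun a b : F => b = M.τ₀ a ∨ b = M.τ₁ a)

/-- The vertex at which a flag lies. -/
def vertexOf (x : F) : M.Vertex := Quot.mk _ x

/-- The Euler genus `2 - n + e - f` of the surface, computed from the 2-cell embedding of a graph
with `n` vertices and `e` edges that has `f` faces. -/
noncomputable def eulerGenus : ℤ :=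
  2 - (Nat.card M.Vertex : ℤ) + (Nat.card M.Edge : ℤ) - (Nat.card M.Face : ℤ)

/-- `G` is a subgraph of the graph of the 2-cell embedding `M`: distinct vertices of `G` go to
distinct vertices, and adjacent vertices of `G` to the two ends of an edge. -/
def Contains {V : Type*} (G : SimpleGraph V) : Prop :=
  ∃ φ : V → M.Vertex, Function.Injective φ ∧
    ∀ u v, G.Adj u v → ∃ x : F, M.vertexOf x = φ u ∧ M.vertexOf (M.τ₀ x) = φ v

end CellEmbedding

/-- `G` has an embedding, not necessarily a 2-cell embedding and `G` not necessarily connected,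
in a closed surface of Euler genus `h`. A graph drawn on a closed surface is completed to a
connected graph with a 2-cell embedding there by drawing further vertices and edges inside its
faces; so this says that `G` is a subgraph of a graph with a 2-cell embedding in a surface of
Euler genus `h`. -/
def EmbedsInGenus {V : Type*} (G : SimpleGraph V) (h : ℕ) : Prop :=
  ∃ (m : ℕ) (M : CellEmbedding (Fin m)), M.eulerGenus = (h : ℤ) ∧ M.Contains G

/-- The Euler genus of a graph: the minimum Euler genus of a closed surface in which it embeds
(`⊤` if there is none, which does not happen for finite graphs). -/
noncomputable def graphEulerGenus {V : Type*} (G : SimpleGraph V) : ℕ∞ :=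
  ⨅ (h : ℕ) (_ : EmbedsInGenus G h), (h : ℕ∞)

/-! ## The oriented chromatic number of a class of bounded Euler genus -/

/-- The oriented chromatic numbers of the finite simple graphs of Euler genus at most `g`. -/
def orientedChromaticNumbers (g : ℕ) : Set ℕ∞ :=
  {k | ∃ (n : ℕ) (G : SimpleGraph (Fin n)),
    graphEulerGenus G ≤ (g : ℕ∞) ∧ orientedChromaticNumber G = k}

/-- `χₒ(g)`, the maximum oriented chromatic number of a graph of Euler genus at most `g` (as a
supremum in `ℕ∞`; the theorem says that it is finite and attained). -/
noncomputable def chiO (g : ℕ) : ℕ∞ := sSup (orientedChromaticNumbers g)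

end OrientedGenus

/-!
Both bounds are proved without embedding theorems; in fact the upper bound is linear in `g`.

Lower bound. Join `n ≤ 2 ^ m` vertices to `m` further vertices, with directions given by the binary
digits of the `n` vertices (`binaryOrientation`). Two of the `n` vertices differ in a digit, so they
are joined by a directed path of length two and have distinct colours. Any rotation system of
`K_{m,n}` has at least one face, hence Euler genus at most `(m - 1) (n - 1)`. With
`m = ⌈log₂ n⌉` this leaves room for the stated `n` (`exists_bipartite_sizes`).

Upper bound, Euler's inequality. A subgraph of an embedded graph need not be cellularly embedded,
and no edges are deleted. Instead, vertices, edges and faces of the ambient embedding carry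
functions to `ZMod 2`. Boundaries of sets of faces are orthogonal to coboundaries of sets of
vertices, and comparing dimensions bounds from below the number of regions into which the subgraph
cuts the surface (`CellEmbedding.euler_le_card_region`). The boundary of a region is a cycle
modulo 2, so it is long, and every edge is on at most two boundaries
(`CellEmbedding.mul_card_edges_le`). This gives at most `3 (|S| + h)` edges for a simple graph on
`S`, and the same for graphs on `S` whose edges are paths of length two with distinct middle
vertices.

Upper bound, colouring. Remove vertices one by one, as long as more than `3 g` vertices remain.
By the edge bounds there is always a vertex `v` that has at most 15 neighbours in the remaining
set `S`, and that has common neighbours outside `S` with at most 1800 vertices of `S`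
(`EmbedsInGenus.exists_removable`). In the opposite order, colour the vertices greedily
(`exists_colouring_of_subset`). The last `3 g` vertices get colours of their own. The other
colours form 2048 blocks of a random oriented graph, in which all prescriptions of the arcs to 15
vertices outside a block are met in the block (`exists_extension_property`). Keeping vertices with
a common uncoloured neighbour in different colours makes the prescriptions consistent, and a free
block takes care of that.
-/

namespace OrientedGenus

/-! ### Cycles modulo 2 on a surface and Euler's inequality -/

namespace CellEmbedding

variable {F : Type*} (M : CellEmbedding F)

/-- The edge on which a flag lies. -/
def edgeOf (x : F) : M.Edge := Quot.mk _ x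

/-- The face on which a flag lies. -/
def faceOf (x : F) : M.Face := Quot.mk _ x

instance [Finite F] : Finite M.Vertex := Quot.finite _
instance [Finite F] : Finite M.Edge := Quot.finite _
instance [Finite F] : Finite M.Face := Quot.finite _
noncomputable instance [Finite F] : Fintype M.Vertex := Fintype.ofFinite _
noncomputable instance [Finite F] : Fintype M.Edge := Fintype.ofFinite _
noncomputable instance [Finite F] : Fintype M.Face := Fintype.ofFinite _

lemma vertexOf_τ₁ (x : F) : M.vertexOf (M.τ₁ x) = M.vertexOf x := by
  symm
  exact Quot.sound (Or.inl rfl)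

lemma vertexOf_τ₂ (x : F) : M.vertexOf (M.τ₂ x) = M.vertexOf x := by
  symm
  exact Quot.sound (Or.inr rfl)

lemma edgeOf_τ₀ (x : F) : M.edgeOf (M.τ₀ x) = M.edgeOf x := by
  symm
  exact Quot.sound (Or.inl rfl)

lemma edgeOf_τ₂ (x : F) : M.edgeOf (M.τ₂ x) = M.edgeOf x := by
  symm
  exact Quot.sound (Or.inr rfl)

lemma faceOf_τ₀ (x : F) : M.faceOf (M.τ₀ x) = M.faceOf x := by
  symm
  exact Quot.sound (Or.inl rfl)

lemma faceOf_τ₁ (x : F) : M.faceOf (M.τ₁ x) = M.faceOf x := by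
  symm
  exact Quot.sound (Or.inr rfl)

/-- The four flags around the midpoint of an edge. -/
def edgeFlags [DecidableEq F] (x : F) : Finset F :=
  {x, M.τ₀ x, M.τ₂ x, M.τ₀ (M.τ₂ x)}

lemma edgeFlags_τ₀ [DecidableEq F] (x : F) : M.edgeFlags (M.τ₀ x) = M.edgeFlags x := by
  ext y
  simp only [edgeFlags, Finset.mem_insert, Finset.mem_singleton, M.invol₀, ← M.comm]
  tauto

lemma edgeFlags_τ₂ [DecidableEq F] (x : F) : M.edgeFlags (M.τ₂ x) = M.edgeFlags x := by
  ext y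
  simp only [edgeFlags, Finset.mem_insert, Finset.mem_singleton, M.invol₂]
  tauto

lemma edgeOf_eq_iff [DecidableEq F] (x y : F) :
    M.edgeOf y = M.edgeOf x ↔ y ∈ M.edgeFlags x := by
  constructor
  · intro h
    let o : M.Edge → Finset F := Quot.lift (fun x => M.edgeFlags x) (by
      rintro a b (rfl | rfl)
      · exact (M.edgeFlags_τ₀ a).symm
      · exact (M.edgeFlags_τ₂ a).symm)
    have : M.edgeFlags y = M.edgeFlags x := congrArg o h
    rw [← this]
    simp [edgeFlags]
  · intro h
    simp only [edgeFlags, Finset.mem_insert, Finset.mem_singleton] at h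
    rcases h with rfl | rfl | rfl | rfl
    · rfl
    · exact M.edgeOf_τ₀ x
    · exact M.edgeOf_τ₂ x
    · rw [M.edgeOf_τ₀, M.edgeOf_τ₂]

/-- The ends of an edge are determined by the edge, up to their order. -/
lemma ends_eq_of_edgeOf_eq {x y : F} (h : M.edgeOf x = M.edgeOf y) :
    s(M.vertexOf x, M.vertexOf (M.τ₀ x)) = s(M.vertexOf y, M.vertexOf (M.τ₀ y)) := by
  classical
  rw [M.edgeOf_eq_iff] at h
  simp only [edgeFlags, Finset.mem_insert, Finset.mem_singleton] at h
  rcases h with rfl | rfl | rfl | rfl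
  · rfl
  · rw [M.invol₀, Sym2.eq_swap]
  · rw [M.comm, M.vertexOf_τ₂, M.vertexOf_τ₂]
  · rw [M.invol₀, M.comm, M.vertexOf_τ₂, M.vertexOf_τ₂, Sym2.eq_swap]

/-- A function of flags that is unchanged by all three gluings is constant. -/
lemma eq_of_invariant {α : Type*} (f : F → α) (h₀ : ∀ x, f (M.τ₀ x) = f x)
    (h₁ : ∀ x, f (M.τ₁ x) = f x) (h₂ : ∀ x, f (M.τ₂ x) = f x) (x y : F) : f x = f y := by
  induction M.connected x y with
  | refl => rfl
  | tail _ hbc ih =>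
    rcases hbc with rfl | rfl | rfl
    · rw [ih, h₀]
    · rw [ih, h₁]
    · rw [ih, h₂]

/-- The coboundary modulo 2: the sum of a function of the vertices over the two ends of an
edge. -/
def vertexDiff (f : M.Vertex → ZMod 2) : M.Edge → ZMod 2 :=
  Quot.lift (fun x => f (M.vertexOf x) + f (M.vertexOf (M.τ₀ x))) (by
    rintro a b (rfl | rfl)
    · rw [M.invol₀, add_comm]
    · rw [M.comm, M.vertexOf_τ₂, M.vertexOf_τ₂])

/-- The boundary modulo 2: the sum of a function of the faces over the two sides of an edge. -/
def faceDiff (g : M.Face → ZMod 2) : M.Edge → ZMod 2 :=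
  Quot.lift (fun x => g (M.faceOf x) + g (M.faceOf (M.τ₂ x))) (by
    rintro a b (rfl | rfl)
    · rw [← M.comm, M.faceOf_τ₀, M.faceOf_τ₀]
    · rw [M.invol₂, add_comm])

lemma vertexDiff_edgeOf (f : M.Vertex → ZMod 2) (x : F) :
    M.vertexDiff f (M.edgeOf x) = f (M.vertexOf x) + f (M.vertexOf (M.τ₀ x)) := rfl

lemma faceDiff_edgeOf (g : M.Face → ZMod 2) (x : F) :
    M.faceDiff g (M.edgeOf x) = g (M.faceOf x) + g (M.faceOf (M.τ₂ x)) := rfl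

lemma exists_edgeOf (e : M.Edge) : ∃ x, M.edgeOf x = e := Quot.exists_rep e

/-- Boundaries are cycles: the pairing is the sum of `f (vertexOf x) * g (faceOf x)` over all
flags `x`, where `x` and `τ₁ x` cancel. -/
lemma sum_vertexDiff_mul_faceDiff [Finite F] (f : M.Vertex → ZMod 2) (g : M.Face → ZMod 2) :
    ∑ e, M.vertexDiff f e * M.faceDiff g e = 0 := by
  classical
  have := Fintype.ofFinite F
  have h1 : ∑ x, f (M.vertexOf x) * g (M.faceOf x) = 0 := by
    refine Finset.sum_involution (fun x _ => M.τ₁ x) ?_ ?_ ?_ ?_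
    · intro x _
      rw [M.vertexOf_τ₁, M.faceOf_τ₁]
      exact CharTwo.add_self_eq_zero _
    · intro x _ _
      exact M.ne₁ x
    · intro x _
      exact Finset.mem_univ _
    · intro x _
      exact M.invol₁ x
  rw [← h1, ← Finset.sum_fiberwise Finset.univ M.edgeOf]
  refine Finset.sum_congr rfl fun e _ => ?_
  obtain ⟨x, rfl⟩ := M.exists_edgeOf e
  have h2 : Finset.univ.filter (fun y => M.edgeOf y = M.edgeOf x) = M.edgeFlags x := by
    ext y
    simp [M.edgeOf_eq_iff]
  have n1 : M.τ₀ x ≠ M.τ₂ x := by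
    intro h
    have := M.ne₀₂ x
    rw [← h, M.invol₀] at this
    exact this rfl
  rw [h2, edgeFlags, Finset.sum_insert, Finset.sum_insert, Finset.sum_insert,
    Finset.sum_singleton, vertexDiff_edgeOf, faceDiff_edgeOf, M.faceOf_τ₀, M.faceOf_τ₀,
    M.vertexOf_τ₂, M.comm, M.vertexOf_τ₂]
  · ring
  · rw [Finset.mem_singleton]
    exact (M.ne₀ _).symm
  · simp only [Finset.mem_insert, Finset.mem_singleton, not_or]
    refine ⟨n1, ?_⟩
    rw [M.comm]
    exact (M.ne₂ _).symm
  · simp only [Finset.mem_insert, Finset.mem_singleton, not_or]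
    exact ⟨(M.ne₀ x).symm, (M.ne₂ x).symm, (M.ne₀₂ x).symm⟩

/-- The regions into which a set `E'` of edges cuts the surface: faces are merged across all
edges that are not in `E'`. -/
def Region (E' : Finset M.Edge) : Type _ :=
  Quot (fun a b : F => b = M.τ₀ a ∨ b = M.τ₁ a ∨ (b = M.τ₂ a ∧ M.edgeOf a ∉ E'))

/-- The region in which a flag lies. -/
def regionOf (E' : Finset M.Edge) (x : F) : M.Region E' := Quot.mk _ x

instance [Finite F] (E' : Finset M.Edge) : Finite (M.Region E') := Quot.finite _
noncomputable instance [Finite F] (E' : Finset M.Edge) : Fintype (M.Region E') :=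
  Fintype.ofFinite _

lemma regionOf_τ₀ (E' : Finset M.Edge) (x : F) :
    M.regionOf E' (M.τ₀ x) = M.regionOf E' x := by
  symm
  exact Quot.sound (Or.inl rfl)

lemma regionOf_τ₁ (E' : Finset M.Edge) (x : F) :
    M.regionOf E' (M.τ₁ x) = M.regionOf E' x := by
  symm
  exact Quot.sound (Or.inr (Or.inl rfl))

lemma regionOf_τ₂ (E' : Finset M.Edge) {x : F} (hx : M.edgeOf x ∉ E') :
    M.regionOf E' (M.τ₂ x) = M.regionOf E' x := by
  symm
  exact Quot.sound (Or.inr (Or.inr ⟨rfl, hx⟩))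

lemma exists_regionOf (E' : Finset M.Edge) (R : M.Region E') : ∃ x, M.regionOf E' x = R :=
  Quot.exists_rep R

/-- The region that contains a face. -/
def regionOfFace (E' : Finset M.Edge) : M.Face → M.Region E' :=
  Quot.lift (M.regionOf E') (by
    rintro a b (rfl | rfl)
    · exact (M.regionOf_τ₀ E' a).symm
    · exact (M.regionOf_τ₁ E' a).symm)

lemma regionOfFace_faceOf (E' : Finset M.Edge) (x : F) :
    M.regionOfFace E' (M.faceOf x) = M.regionOf E' x := rfl

/-- A set of edges is a cycle modulo 2 if it pairs to zero with all coboundaries, that is, if it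
has even degree at every vertex. -/
def IsCycle [Finite F] (z : M.Edge → ZMod 2) : Prop :=
  ∀ f : M.Vertex → ZMod 2, ∑ e, z e * M.vertexDiff f e = 0

open Classical in
/-- The boundary of a region is a cycle, and it is not zero if there are other regions; every
edge of `E'` is in the boundary of at most two regions. -/
lemma mul_card_region_le [Finite F] (E' : Finset M.Edge) (l : ℕ)
    (hl : ∀ z : M.Edge → ZMod 2, z ≠ 0 → (∀ e ∉ E', z e = 0) → M.IsCycle z →
      l ≤ (Finset.univ.filter (fun e => z e ≠ 0)).card)
    (hr : 2 ≤ Fintype.card (M.Region E')) :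
    l * Fintype.card (M.Region E') ≤ 2 * E'.card := by
  let ind : M.Region E' → M.Face → ZMod 2 := fun R t => if M.regionOfFace E' t = R then 1 else 0
  have hind1 : ∀ R x, M.regionOf E' x = R → ind R (M.faceOf x) = 1 := fun R x h => if_pos h
  have hind0 : ∀ R x, M.regionOf E' x ≠ R → ind R (M.faceOf x) = 0 := fun R x h => if_neg h
  let z : M.Region E' → M.Edge → ZMod 2 := fun R => M.faceDiff (ind R)
  have hz0 : ∀ R, ∀ e ∉ E', z R e = 0 := by
    intro R e he
    obtain ⟨x, rfl⟩ := M.exists_edgeOf e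
    simp only [z, ind, faceDiff_edgeOf, regionOfFace_faceOf, M.regionOf_τ₂ E' he]
    exact CharTwo.add_self_eq_zero _
  have hzc : ∀ R, M.IsCycle (z R) := by
    intro R f
    rw [← M.sum_vertexDiff_mul_faceDiff f (ind R)]
    exact Finset.sum_congr rfl fun e _ => mul_comm _ _
  have hzn : ∀ R, z R ≠ 0 := by
    intro R h
    have hconst := M.eq_of_invariant (fun x => ind R (M.faceOf x))
      (fun x => by simp only [M.faceOf_τ₀]) (fun x => by simp only [M.faceOf_τ₁]) (fun x => by
        have := congrFun h (M.edgeOf x)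
        simp only [z, faceDiff_edgeOf, Pi.zero_apply] at this
        exact (CharTwo.add_eq_zero.mp this).symm)
    have : ∀ R' : M.Region E', R' = R := by
      intro R'
      obtain ⟨x, hx⟩ := M.exists_regionOf E' R
      obtain ⟨y, hy⟩ := M.exists_regionOf E' R'
      by_contra hne
      exact one_ne_zero (((hind1 R x hx).symm.trans (hconst x y)).trans
        (hind0 R y (hy.trans_ne hne)))
    have : Fintype.card (M.Region E') ≤ 1 :=
      Fintype.card_le_one_iff.mpr fun a b => (this a).trans (this b).symm
    omega
  calc l * Fintype.card (M.Region E')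
      = ∑ _R : M.Region E', l := by simp [mul_comm]
    _ ≤ ∑ R : M.Region E', (Finset.univ.filter (fun e => z R e ≠ 0)).card :=
        Finset.sum_le_sum fun R _ => hl _ (hzn R) (hz0 R) (hzc R)
    _ = ∑ R : M.Region E', (E'.filter (fun e => z R e ≠ 0)).card := by
        refine Finset.sum_congr rfl fun R _ => congrArg _ ?_
        ext e
        simp only [Finset.mem_filter, Finset.mem_univ, true_and]
        exact ⟨fun h => ⟨by_contra fun h' => h (hz0 R e h'), h⟩, fun h => h.2⟩
    _ = ∑ e ∈ E', (Finset.univ.filter (fun R => z R e ≠ 0)).card := by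
        simp only [Finset.card_filter]
        exact Finset.sum_comm
    _ ≤ ∑ _e ∈ E', 2 := by
        refine Finset.sum_le_sum fun e _ => ?_
        obtain ⟨x, rfl⟩ := M.exists_edgeOf e
        refine (Finset.card_le_card (t := {M.regionOf E' x, M.regionOf E' (M.τ₂ x)}) ?_).trans
          Finset.card_le_two
        intro R hR
        have hR' : ind R (M.faceOf x) + ind R (M.faceOf (M.τ₂ x)) ≠ 0 := (Finset.mem_filter.mp hR).2
        simp only [Finset.mem_insert, Finset.mem_singleton]
        by_contra hcon
        push Not at hcon
        rw [hind0 R x hcon.1.symm, hind0 R _ hcon.2.symm] at hR'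
        exact hR' (add_zero 0)
    _ = 2 * E'.card := by simp [mul_comm]

open Classical in
/-- Euler's inequality for a subgraph with vertices in `S` and with edge set `E'`, which need not
be cellularly embedded: its number of regions is at least `2 - h + |E'| - |S|`. -/
lemma euler_le_card_region [Finite F] (E' : Finset M.Edge) (S : Finset M.Vertex)
    (hS : S.Nonempty) (hE : ∀ x, M.edgeOf x ∈ E' → M.vertexOf x ∈ S) :
    2 - M.eulerGenus + E'.card - S.card ≤ Fintype.card (M.Region E') := by
  let C := {e : M.Edge // e ∉ E'}
  let U := {v : M.Vertex // v ∉ S}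
  let Ψ : (M.Face → ZMod 2) →ₗ[ZMod 2] (C → ZMod 2) :=
    { toFun := fun g e => M.faceDiff g e.1
      map_add' := by
        intro g g'
        ext ⟨e, he⟩
        obtain ⟨x, rfl⟩ := M.exists_edgeOf e
        simp only [faceDiff_edgeOf, Pi.add_apply]
        ring
      map_smul' := by
        intro c g
        ext ⟨e, he⟩
        obtain ⟨x, rfl⟩ := M.exists_edgeOf e
        simp only [faceDiff_edgeOf, Pi.smul_apply, smul_eq_mul, RingHom.id_apply]
        ring }
  let ext0 : (U → ZMod 2) → M.Vertex → ZMod 2 := fun f v => if h : v ∉ S then f ⟨v, h⟩ else 0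
  have ext_mem : ∀ f v, v ∈ S → ext0 f v = 0 := fun f v hv => dif_neg (not_not.mpr hv)
  let Θ : (U → ZMod 2) →ₗ[ZMod 2] (C → ZMod 2) :=
    { toFun := fun f e => M.vertexDiff (ext0 f) e.1
      map_add' := by
        intro g g'
        have : ext0 (g + g') = ext0 g + ext0 g' := by
          ext v
          by_cases hv : v ∈ S <;> simp [ext0, hv]
        ext ⟨e, he⟩
        obtain ⟨x, rfl⟩ := M.exists_edgeOf e
        simp only [vertexDiff_edgeOf, this, Pi.add_apply]
        ring
      map_smul' := by
        intro c g
        have : ext0 (c • g) = c • ext0 g := by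
          ext v
          by_cases hv : v ∈ S <;> simp [ext0, hv]
        ext ⟨e, he⟩
        obtain ⟨x, rfl⟩ := M.exists_edgeOf e
        simp only [vertexDiff_edgeOf, this, Pi.smul_apply, smul_eq_mul, RingHom.id_apply]
        ring }
  have hE0 : ∀ f, ∀ e ∈ E', M.vertexDiff (ext0 f) e = 0 := by
    intro f e he
    obtain ⟨x, rfl⟩ := M.exists_edgeOf e
    rw [vertexDiff_edgeOf, ext_mem f _ (hE x he),
      ext_mem f _ (hE (M.τ₀ x) (by rwa [M.edgeOf_τ₀])), add_zero]
  have hΘ : Function.Injective Θ := by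
    rw [← LinearMap.ker_eq_bot, LinearMap.ker_eq_bot']
    intro f hf
    have h0 : ∀ e, M.vertexDiff (ext0 f) e = 0 := by
      intro e
      by_cases he : e ∈ E'
      · exact hE0 f e he
      · exact congrFun hf ⟨e, he⟩
    have hconst := M.eq_of_invariant (fun x => ext0 f (M.vertexOf x))
      (fun x => by
        have := h0 (M.edgeOf x)
        rw [vertexDiff_edgeOf] at this
        exact (CharTwo.add_eq_zero.mp this).symm)
      (fun x => by simp only [M.vertexOf_τ₁]) (fun x => by simp only [M.vertexOf_τ₂])
    obtain ⟨s, hs⟩ := hS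
    obtain ⟨y, rfl⟩ := Quot.exists_rep s
    ext ⟨v, hv⟩
    obtain ⟨x, rfl⟩ := Quot.exists_rep v
    have h1 : ext0 f (M.vertexOf x) = ext0 f (M.vertexOf y) := hconst x y
    rw [ext_mem f (M.vertexOf y) hs] at h1
    have h2 : ext0 f (M.vertexOf x) = f ⟨_, hv⟩ := dif_pos hv
    rw [Pi.zero_apply, ← h1, h2]
  have horth : ∀ f g, ∑ e, Θ f e * Ψ g e = 0 := by
    intro f g
    rw [← M.sum_vertexDiff_mul_faceDiff (ext0 f) g,
      ← Finset.sum_subset (Finset.subset_univ (Finset.univ.filter (· ∉ E')))]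
    · rw [Finset.sum_subtype (p := (· ∉ E')) _ (by simp)]
      rfl
    · intro e _ he
      simp only [Finset.mem_filter, Finset.mem_univ, true_and, not_not] at he
      rw [hE0 f e he, zero_mul]
  have hrank : Module.finrank (ZMod 2) (LinearMap.range Θ) +
      Module.finrank (ZMod 2) (LinearMap.range Ψ) ≤ Fintype.card C := by
    have h0 : (LinearMap.toMatrix' Θ).transpose * LinearMap.toMatrix' Ψ = 0 := by
      ext i j
      rw [Matrix.mul_apply, Matrix.zero_apply,
        ← horth (Pi.single i 1) (Pi.single j 1)]
      refine Finset.sum_congr rfl fun e _ => ?_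
      rw [Matrix.transpose_apply, LinearMap.toMatrix'_apply, LinearMap.toMatrix'_apply]
    have h1 := Matrix.rank_add_rank_le_card_of_mul_eq_zero h0
    rw [Matrix.rank_transpose, Matrix.rank_eq_finrank_range_toLin _ (Pi.basisFun _ _) (Pi.basisFun _ _),
      Matrix.rank_eq_finrank_range_toLin _ (Pi.basisFun _ _) (Pi.basisFun _ _)] at h1
    rwa [Matrix.toLin_eq_toLin', Matrix.toLin_eq_toLin', Matrix.toLin'_toMatrix',
      Matrix.toLin'_toMatrix'] at h1
  rw [LinearMap.finrank_range_of_inj hΘ, Module.finrank_fintype_fun_eq_card] at hrank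
  have hnull := LinearMap.finrank_range_add_finrank_ker Ψ
  rw [Module.finrank_fintype_fun_eq_card] at hnull
  -- functions of the faces that do not change across edges outside `E'` live on the regions
  let toRegion : LinearMap.ker Ψ →ₗ[ZMod 2] (M.Region E' → ZMod 2) :=
    { toFun := fun g => Quot.lift (fun x => g.1 (M.faceOf x)) (by
        rintro a b (rfl | rfl | ⟨rfl, hb⟩)
        · rw [M.faceOf_τ₀]
        · rw [M.faceOf_τ₁]
        · have h := congrFun (LinearMap.mem_ker.mp g.2) ⟨M.edgeOf a, hb⟩
          exact CharTwo.add_eq_zero.mp h)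
      map_add' := by
        intro g g'
        ext R
        obtain ⟨x, rfl⟩ := Quot.exists_rep R
        rfl
      map_smul' := by
        intro c g
        ext R
        obtain ⟨x, rfl⟩ := Quot.exists_rep R
        rfl }
  have hker : Module.finrank (ZMod 2) (LinearMap.ker Ψ) ≤ Fintype.card (M.Region E') := by
    rw [← Module.finrank_fintype_fun_eq_card (ZMod 2) (η := M.Region E')]
    refine LinearMap.finrank_le_finrank_of_injective (f := toRegion) ?_
    intro g g' h
    ext t
    obtain ⟨x, rfl⟩ := Quot.exists_rep t
    exact congrFun h (M.regionOf E' x)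
  have hU : Fintype.card U = Fintype.card M.Vertex - S.card := by
    simp [U, Fintype.card_subtype_compl]
  have hC : Fintype.card C = Fintype.card M.Edge - E'.card := by
    simp [C, Fintype.card_subtype_compl]
  have hSle := Finset.card_le_univ S
  have hEle := Finset.card_le_univ E'
  rw [eulerGenus, Nat.card_eq_fintype_card, Nat.card_eq_fintype_card, Nat.card_eq_fintype_card]
  omega

open Classical in
/-- The edge bound for a subgraph of a graph on a surface: if all nonzero cycles modulo 2 in the
subgraph have at least `l` edges, then `(l - 2) |E'| ≤ l (|S| + h - 1)`. -/
lemma mul_card_edges_le [Finite F] (E' : Finset M.Edge) (S : Finset M.Vertex)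
    (hS : S.Nonempty) (hE : ∀ x, M.edgeOf x ∈ E' → M.vertexOf x ∈ S) (l : ℕ)
    (hl : ∀ z : M.Edge → ZMod 2, z ≠ 0 → (∀ e ∉ E', z e = 0) → M.IsCycle z →
      l ≤ (Finset.univ.filter (fun e => z e ≠ 0)).card) :
    (l : ℤ) * E'.card ≤ 2 * E'.card + l * (S.card + M.eulerGenus - 1) := by
  have h1 := M.euler_le_card_region E' S hS hE
  have h2 : (l : ℤ) * (Fintype.card (M.Region E') - 1) ≤ 2 * E'.card := by
    by_cases hr : 2 ≤ Fintype.card (M.Region E')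
    · have := M.mul_card_region_le E' l hl hr
      zify at this
      linarith
    · have : (Fintype.card (M.Region E') : ℤ) - 1 ≤ 0 := by omega
      have := mul_nonpos_of_nonneg_of_nonpos (Int.natCast_nonneg l) this
      linarith [Int.natCast_nonneg E'.card]
  have h3 : (l : ℤ) * (E'.card - (S.card + M.eulerGenus - 1)) ≤
      l * (Fintype.card (M.Region E') - 1) :=
    mul_le_mul_of_nonneg_left (by linarith) (Int.natCast_nonneg l)
  linarith

lemma eulerGenus_nonneg [Finite F] : 0 ≤ M.eulerGenus := by
  have h := M.mul_card_edges_le ∅ {M.vertexOf M.nonempty.some} (Finset.singleton_nonempty _)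
    (by simp) 1 (fun z hz hz0 => absurd (funext fun e => hz0 e (Finset.notMem_empty e)) hz)
  simpa using h

end CellEmbedding

/-! ### Edge bounds for simple graphs and for paths of length two -/

open Classical in
/-- A nonempty set of edges of a simple graph with even degree at every vertex has at least three
edges: of two distinct edges, one has an end that is not on the other. -/
lemma three_le_card_support {I X : Type*} [Fintype I] (a b : I → X) (hab : ∀ i, a i ≠ b i)
    (hinj : Function.Injective fun i => s(a i, b i)) (z : I → ZMod 2) (hz : z ≠ 0)
    (hcyc : ∀ f : X → ZMod 2, ∑ i, z i * (f (a i) + f (b i)) = 0) :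
    3 ≤ (Finset.univ.filter (fun i => z i ≠ 0)).card := by
  have key : ∀ i c, z i ≠ 0 → (c = a i ∨ c = b i) →
      ∃ j, z j ≠ 0 ∧ j ≠ i ∧ (c = a j ∨ c = b j) := by
    intro i c hi hc
    by_contra! hcon
    have h := hcyc (fun v => if v = c then 1 else 0)
    rw [Finset.sum_eq_single i] at h
    · rcases hc with rfl | rfl
      · rw [if_pos rfl, if_neg (hab i).symm, add_zero, mul_one] at h
        exact hi h
      · rw [if_pos rfl, if_neg (hab i), zero_add, mul_one] at h
        exact hi h
    · intro j _ hj
      by_cases hzj : z j = 0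
      · rw [hzj, zero_mul]
      · have := hcon j hzj hj
        rw [if_neg this.1.symm, if_neg this.2.symm, add_zero, mul_zero]
    · exact fun h => absurd (Finset.mem_univ i) h
  obtain ⟨i, hi⟩ := Function.ne_iff.mp hz
  obtain ⟨j, hj, hji, haj⟩ := key i (a i) hi (Or.inl rfl)
  obtain ⟨k, hk, hki, hbk⟩ := key i (b i) hi (Or.inr rfl)
  by_cases hjk : j = k
  · subst hjk
    exfalso
    refine hji (hinj ?_)
    have := hab i
    rcases haj with h1 | h1 <;> rcases hbk with h2 | h2
    · exact absurd (h1.trans h2.symm) this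
    · simp [h1, h2]
    · simp [h1, h2, Sym2.eq_swap]
    · exact absurd (h1.trans h2.symm) this
  · have h3 : ({i, j, k} : Finset I).card = 3 := by
      rw [Finset.card_eq_three]
      exact ⟨i, j, k, hji.symm, hki.symm, hjk, rfl⟩
    rw [← h3]
    refine Finset.card_le_card ?_
    intro t ht
    simp only [Finset.mem_insert, Finset.mem_singleton] at ht
    rcases ht with rfl | rfl | rfl <;> simpa

namespace CellEmbedding

variable {F : Type*} (M : CellEmbedding F)

/-- A simple graph on a set `S` of vertices has at most `3 (|S| + h)` edges. -/
lemma card_le_of_simple [Finite F] {I : Type*} [Fintype I] (S : Finset M.Vertex)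
    (hS : S.Nonempty) (x : I → F) (ha : ∀ i, M.vertexOf (x i) ∈ S)
    (hb : ∀ i, M.vertexOf (M.τ₀ (x i)) ∈ S)
    (hab : ∀ i, M.vertexOf (x i) ≠ M.vertexOf (M.τ₀ (x i)))
    (hinj : Function.Injective fun i => s(M.vertexOf (x i), M.vertexOf (M.τ₀ (x i)))) :
    (Fintype.card I : ℤ) ≤ 3 * (S.card + M.eulerGenus) := by
  classical
  have hxi : Function.Injective (fun i => M.edgeOf (x i)) :=
    fun i j h => hinj (M.ends_eq_of_edgeOf_eq h)
  let E' : Finset M.Edge := Finset.univ.image (fun i => M.edgeOf (x i))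
  have hcard : E'.card = Fintype.card I := Finset.card_image_of_injective _ hxi
  have hE : ∀ y, M.edgeOf y ∈ E' → M.vertexOf y ∈ S := by
    intro y hy
    obtain ⟨i, -, hi⟩ := Finset.mem_image.mp hy
    have h := M.ends_eq_of_edgeOf_eq hi
    rcases Sym2.eq_iff.mp h with h | h
    · rw [← h.1]
      exact ha i
    · rw [← h.2]
      exact hb i
  have := M.mul_card_edges_le E' S hS hE 3 (by
    intro z hz hz0 hzc
    have h3 := three_le_card_support (fun i => M.vertexOf (x i))
      (fun i => M.vertexOf (M.τ₀ (x i))) hab hinj (fun i => z (M.edgeOf (x i))) (by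
        intro h
        apply hz
        ext e
        by_cases he : e ∈ E'
        · obtain ⟨i, -, rfl⟩ := Finset.mem_image.mp he
          exact congrFun h i
        · exact hz0 e he) (by
        intro f
        rw [← hzc f, ← Finset.sum_subset (Finset.subset_univ E'),
          Finset.sum_image (fun i _ j _ h => hxi h)]
        · rfl
        · intro e _ he
          rw [hz0 e he, zero_mul])
    refine h3.trans ?_
    rw [← Finset.card_image_of_injective _ hxi]
    refine Finset.card_le_card ?_
    intro e he
    obtain ⟨i, hi, rfl⟩ := Finset.mem_image.mp he
    simpa using hi)
  rw [hcard] at this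
  push_cast at this
  linarith

/-- A family of paths of length two with distinct middle vertices outside `S`, and with distinct
pairs of ends in `S`, has at most `3 (|S| + h)` members: contracting one half of each path would
give a simple graph on `S`. The cycles in the union of the paths have length at least six. -/
lemma card_le_of_paths [Finite F] {I : Type*} [Fintype I] (S : Finset M.Vertex)
    (hS : S.Nonempty) (x y : I → F) (hxy : ∀ i, M.vertexOf (x i) = M.vertexOf (y i))
    (hw : ∀ i, M.vertexOf (x i) ∉ S) (hwi : Function.Injective fun i => M.vertexOf (x i))
    (ha : ∀ i, M.vertexOf (M.τ₀ (x i)) ∈ S) (hb : ∀ i, M.vertexOf (M.τ₀ (y i)) ∈ S)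
    (hab : ∀ i, M.vertexOf (M.τ₀ (x i)) ≠ M.vertexOf (M.τ₀ (y i)))
    (hinj : Function.Injective fun i =>
      s(M.vertexOf (M.τ₀ (x i)), M.vertexOf (M.τ₀ (y i)))) :
    (Fintype.card I : ℤ) ≤ 3 * (S.card + M.eulerGenus) := by
  classical
  let u : I ⊕ I → F := Sum.elim x y
  let mid : I ⊕ I → I := Sum.elim id id
  have hu1 : ∀ t, M.vertexOf (u t) = M.vertexOf (x (mid t)) := by
    rintro (i | i)
    · rfl
    · exact (hxy i).symm
  have hu2 : ∀ t, M.vertexOf (M.τ₀ (u t)) ∈ S := by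
    rintro (i | i)
    · exact ha i
    · exact hb i
  have hends : ∀ t y', M.edgeOf (u t) = M.edgeOf y' → M.vertexOf y' ∉ S →
      M.vertexOf y' = M.vertexOf (u t) ∧ M.vertexOf (M.τ₀ y') = M.vertexOf (M.τ₀ (u t)) := by
    intro t y' h hy'
    rcases Sym2.eq_iff.mp (M.ends_eq_of_edgeOf_eq h) with h | h
    · exact ⟨h.1.symm, h.2.symm⟩
    · rw [← h.2] at hy'
      exact absurd (hu2 t) hy'
  have hui : Function.Injective (fun t => M.edgeOf (u t)) := by
    intro t t' h
    obtain ⟨h1, h2⟩ := hends t (u t') h (by rw [hu1]; exact hw _)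
    rw [hu1, hu1] at h1
    have h3 : mid t' = mid t := hwi h1
    rcases t with i | i <;> rcases t' with j | j <;> obtain rfl : j = i := h3
    · rfl
    · exact absurd h2.symm (hab j)
    · exact absurd h2 (hab j)
    · rfl
  let E' : Finset M.Edge := Finset.univ.image (fun t => M.edgeOf (u t))
  have hcard : E'.card = 2 * Fintype.card I := by
    rw [Finset.card_image_of_injective _ hui, Finset.card_univ, Fintype.card_sum, two_mul]
  let W : Finset M.Vertex := Finset.univ.image (fun i => M.vertexOf (x i))
  have hWcard : W.card = Fintype.card I := Finset.card_image_of_injective _ hwi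
  have hSW : (S ∪ W).card ≤ S.card + Fintype.card I := hWcard ▸ Finset.card_union_le S W
  have hE : ∀ y, M.edgeOf y ∈ E' → M.vertexOf y ∈ S ∪ W := by
    intro y' hy
    obtain ⟨t, -, hi⟩ := Finset.mem_image.mp hy
    by_cases hS' : M.vertexOf y' ∈ S
    · exact Finset.mem_union_left _ hS'
    · obtain ⟨h1, -⟩ := hends t y' hi hS'
      rw [h1, hu1]
      exact Finset.mem_union_right _ (Finset.mem_image_of_mem _ (Finset.mem_univ _))
  have := M.mul_card_edges_le E' (S ∪ W) (hS.mono Finset.subset_union_left) hE 6 (by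
    intro z hz hz0 hzc
    have hsum : ∀ f : M.Vertex → ZMod 2,
        ∑ i, (z (M.edgeOf (x i)) * (f (M.vertexOf (x i)) + f (M.vertexOf (M.τ₀ (x i)))) +
          z (M.edgeOf (y i)) * (f (M.vertexOf (x i)) + f (M.vertexOf (M.τ₀ (y i))))) = 0 := by
      intro f
      rw [← hzc f, ← Finset.sum_subset (Finset.subset_univ E'),
        Finset.sum_image (fun i _ j _ h => hui h), Fintype.sum_sum_type,
        ← Finset.sum_add_distrib]
      · refine Finset.sum_congr rfl fun i _ => ?_
        change _ = z (M.edgeOf (x i)) * (f (M.vertexOf (x i)) + f (M.vertexOf (M.τ₀ (x i)))) +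
          z (M.edgeOf (y i)) * (f (M.vertexOf (y i)) + f (M.vertexOf (M.τ₀ (y i))))
        rw [hxy i]
      · intro e _ he
        rw [hz0 e he, zero_mul]
    -- the degree at the middle vertex is even
    have hzz : ∀ i, z (M.edgeOf (y i)) = z (M.edgeOf (x i)) := by
      intro i
      have h := hsum (fun v => if v = M.vertexOf (x i) then 1 else 0)
      have hne : ∀ v ∈ S, v ≠ M.vertexOf (x i) := fun v hv h => hw i (h ▸ hv)
      rw [Finset.sum_eq_single i] at h
      · rw [if_pos rfl, if_neg (hne _ (ha i)), if_neg (hne _ (hb i)), add_zero, mul_one,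
          mul_one] at h
        exact (CharTwo.add_eq_zero.mp h).symm
      · intro j _ hj
        rw [if_neg (hne _ (ha j)), if_neg (hne _ (hb j)), if_neg (fun h => hj (hwi h))]
        simp
      · exact fun h => absurd (Finset.mem_univ i) h
    have h3 := three_le_card_support (fun i => M.vertexOf (M.τ₀ (x i)))
      (fun i => M.vertexOf (M.τ₀ (y i))) hab hinj (fun i => z (M.edgeOf (x i))) (by
        intro h
        apply hz
        ext e
        by_cases he : e ∈ E'
        · obtain ⟨t, -, rfl⟩ := Finset.mem_image.mp he
          rcases t with i | i
          · exact congrFun h i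
          · exact (hzz i).trans (congrFun h i)
        · exact hz0 e he) (by
        intro f
        rw [← hsum f]
        refine Finset.sum_congr rfl fun i _ => ?_
        rw [hzz i]
        linear_combination (- z (M.edgeOf (x i))) *
          (CharTwo.add_self_eq_zero (f (M.vertexOf (x i)))))
    have h6 : ((Finset.univ.filter (fun i => z (M.edgeOf (x i)) ≠ 0)).disjSum
        (Finset.univ.filter (fun i => z (M.edgeOf (x i)) ≠ 0))).card ≤
        (Finset.univ.filter (fun e => z e ≠ 0)).card := by
      rw [← Finset.card_image_of_injective _ hui]
      refine Finset.card_le_card ?_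
      intro e he
      obtain ⟨t, ht, rfl⟩ := Finset.mem_image.mp he
      rcases t with i | i
      · have : z (M.edgeOf (x i)) ≠ 0 := by simpa using ht
        exact Finset.mem_filter.mpr ⟨Finset.mem_univ _, this⟩
      · have : z (M.edgeOf (x i)) ≠ 0 := by simpa using ht
        rw [← hzz i] at this
        exact Finset.mem_filter.mpr ⟨Finset.mem_univ _, this⟩
    rw [Finset.card_disjSum] at h6
    omega)
  rw [hcard] at this
  push_cast at this
  zify at hSW
  linarith

end CellEmbedding

/-! ### Removable vertices -/

lemma card_le_two_mul_card_image_sym2 {V : Type*} [DecidableEq V] (P : Finset (V × V)) :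
    P.card ≤ 2 * (P.image (fun p => s(p.1, p.2))).card := by
  refine Finset.card_le_mul_card_image P 2 ?_
  intro t ht
  obtain ⟨p, -, rfl⟩ := Finset.mem_image.mp ht
  refine (Finset.card_le_card (t := {p, p.swap}) ?_).trans Finset.card_le_two
  intro q hq
  have := (Finset.mem_filter.mp hq).2
  simp only [Finset.mem_insert, Finset.mem_singleton]
  rcases Sym2.eq_iff.mp this with h | h
  · exact Or.inl (Prod.ext h.1 h.2)
  · exact Or.inr (Prod.ext h.1 h.2)

namespace CellEmbedding

variable {F : Type*} (M : CellEmbedding F)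

open Classical in
/-- The number of ordered pairs of adjacent vertices in a set `S` of vertices of an embedded
graph. -/
lemma Contains.card_adj_le [Finite F] {V : Type*} {G : SimpleGraph V} (hG : M.Contains G)
    (S : Finset V) (hS : S.Nonempty) :
    (((S ×ˢ S).filter (fun p => G.Adj p.1 p.2)).card : ℤ) ≤ 6 * (S.card + M.eulerGenus) := by
  obtain ⟨φ, hφ, hadj⟩ := hG
  set P := (S ×ˢ S).filter (fun p => G.Adj p.1 p.2) with hP
  let T := P.image (fun p => s(p.1, p.2))
  have hT : ∀ t : T, ∃ p ∈ P, s(p.1, p.2) = t.1 := fun t => Finset.mem_image.mp t.2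
  choose p hp hpt using hT
  simp only [hP, Finset.mem_filter, Finset.mem_product] at hp
  choose x hx1 hx2 using fun t => hadj _ _ (hp t).2
  have h1 := M.card_le_of_simple (S.image φ) (hS.image φ) x
    (fun t => hx1 t ▸ Finset.mem_image_of_mem φ (hp t).1.1)
    (fun t => hx2 t ▸ Finset.mem_image_of_mem φ (hp t).1.2)
    (fun t => by
      rw [hx1, hx2]
      exact fun h => (hp t).2.ne (hφ h))
    (fun t t' h => by
      simp only [hx1, hx2] at h
      have h' : Sym2.map φ s((p t).1, (p t).2) = Sym2.map φ s((p t').1, (p t').2) := h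
      have := Sym2.map.injective hφ h'
      rw [hpt, hpt] at this
      exact Subtype.ext this)
  rw [Fintype.card_coe, Finset.card_image_of_injective _ hφ] at h1
  have h2 := card_le_two_mul_card_image_sym2 P
  zify at h2
  linarith

open Classical in
/-- The number of ordered pairs of vertices in `S` with a common neighbour outside `S`, if the
vertices outside `S` have at most `d` neighbours in `S`: choose one such neighbour for each pair,
and for each chosen neighbour one of the pairs for which it was chosen. -/
lemma Contains.card_common_le [Finite F] {V : Type*} {G : SimpleGraph V} (hG : M.Contains G)
    (S : Finset V) (hS : S.Nonempty) (d : ℕ)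
    (hd : ∀ w ∉ S, (S.filter (fun u => G.Adj w u)).card ≤ d) :
    (((S ×ˢ S).filter (fun p => p.1 ≠ p.2 ∧ ∃ w ∉ S, G.Adj w p.1 ∧ G.Adj w p.2)).card : ℤ) ≤
      d * d * (3 * (S.card + M.eulerGenus)) := by
  obtain ⟨φ, hφ, hadj⟩ := hG
  set P := (S ×ˢ S).filter (fun p => p.1 ≠ p.2 ∧ ∃ w ∉ S, G.Adj w p.1 ∧ G.Adj w p.2) with hP
  have hw : ∀ t : Sym2 V, ∃ w, ∀ p ∈ P, s(p.1, p.2) = t → w ∉ S ∧ G.Adj w p.1 ∧ G.Adj w p.2 := by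
    intro t
    by_cases ht : ∃ p ∈ P, s(p.1, p.2) = t
    · obtain ⟨p, hp, rfl⟩ := ht
      obtain ⟨w, hwS, hw1, hw2⟩ := (Finset.mem_filter.mp hp).2.2
      refine ⟨w, fun q _ hq => ?_⟩
      rcases Sym2.eq_iff.mp hq with h | h
      · rw [h.1, h.2]
        exact ⟨hwS, hw1, hw2⟩
      · rw [h.1, h.2]
        exact ⟨hwS, hw2, hw1⟩
    · by_cases hV : Nonempty V
      · exact ⟨hV.some, fun p hp h => absurd ⟨p, hp, h⟩ ht⟩
      · exact absurd ⟨hS.choose⟩ hV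
  choose w hw using hw
  let W := P.image (fun p => w s(p.1, p.2))
  have h1 : P.card ≤ (d * d) * W.card := by
    refine Finset.card_le_mul_card_image P (d * d) ?_
    intro v hv
    obtain ⟨p₀, hp₀, rfl⟩ := Finset.mem_image.mp hv
    have hv := (hw _ p₀ hp₀ rfl).1
    refine (Finset.card_le_card (t := (S.filter (fun u => G.Adj (w s(p₀.1, p₀.2)) u)) ×ˢ
      (S.filter (fun u => G.Adj (w s(p₀.1, p₀.2)) u))) ?_).trans ?_
    · intro p hp
      obtain ⟨hp, hpv⟩ := Finset.mem_filter.mp hp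
      have h := hw _ p hp rfl
      rw [hpv] at h
      have hS' := Finset.mem_product.mp (Finset.mem_filter.mp hp).1
      simp only [Finset.mem_product, Finset.mem_filter]
      exact ⟨⟨hS'.1, h.2.1⟩, ⟨hS'.2, h.2.2⟩⟩
    · rw [Finset.card_product]
      exact Nat.mul_le_mul (hd _ hv) (hd _ hv)
  have hW : ∀ v : W, ∃ p ∈ P, w s(p.1, p.2) = v.1 := fun v => Finset.mem_image.mp v.2
  choose p hp hpv using hW
  have hp' := fun v => hw _ _ (hp v) rfl
  simp only [hP, Finset.mem_filter, Finset.mem_product] at hp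
  choose x hx1 hx2 using fun v => hadj _ _ (hp' v).2.1
  choose y hy1 hy2 using fun v => hadj _ _ (hp' v).2.2
  simp only [hpv] at hx1 hy1 hp'
  have h2 := M.card_le_of_paths (S.image φ) (hS.image φ) x y (fun v => by rw [hx1, hy1])
    (fun v => by
      rw [hx1]
      intro h
      obtain ⟨u, hu, huv⟩ := Finset.mem_image.mp h
      exact (hp' v).1 (hφ huv ▸ hu))
    (fun v v' h => by
      simp only [hx1] at h
      exact Subtype.ext (hφ h))
    (fun v => hx2 v ▸ Finset.mem_image_of_mem φ (hp v).1.1)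
    (fun v => hy2 v ▸ Finset.mem_image_of_mem φ (hp v).1.2)
    (fun v => by
      rw [hx2, hy2]
      exact fun h => (hp v).2.1 (hφ h))
    (fun v v' h => by
      simp only [hx2, hy2] at h
      have h' : Sym2.map φ s((p v).1, (p v).2) = Sym2.map φ s((p v').1, (p v').2) := h
      have := congrArg w (Sym2.map.injective hφ h')
      rw [hpv, hpv] at this
      exact Subtype.ext this)
  rw [Fintype.card_coe, Finset.card_image_of_injective _ hφ] at h2
  zify at h1
  exact h1.trans (mul_le_mul_of_nonneg_left h2 (by positivity))

end CellEmbedding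

lemma sum_card_filter_eq_card_product {V : Type*} (S : Finset V) (r : V → V → Prop)
    [DecidableRel r] :
    ∑ v ∈ S, (S.filter (r v)).card = ((S ×ˢ S).filter (fun p => r p.1 p.2)).card := by
  simp only [Finset.card_filter, Finset.sum_product]

open Classical in
/-- In a set `S` of at least `3 g` vertices, if the vertices outside `S` have few neighbours in
`S`, then some vertex of `S` has few neighbours in `S`, and there are few vertices of `S` with
which it has a common neighbour outside `S`. With `|S| ≥ 3 h`, the average numbers of these are at
most `8` and `900`, and `8 / 16 + 900 / 1801 < 1`. -/
lemma EmbedsInGenus.exists_removable {V : Type*} {G : SimpleGraph V} {h : ℕ}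
    (hG : EmbedsInGenus G h) (S : Finset V) (hS : S.Nonempty) (hSh : 3 * h ≤ S.card)
    (hd : ∀ w ∉ S, (S.filter (fun u => G.Adj w u)).card ≤ 15) :
    ∃ v ∈ S, (S.filter (fun u => G.Adj v u)).card ≤ 15 ∧
      (S.filter (fun u => v ≠ u ∧ ∃ w ∉ S, G.Adj w v ∧ G.Adj w u)).card ≤ 1800 := by
  obtain ⟨m, M, hM, hMG⟩ := hG
  have h1 := hMG.card_adj_le M S hS
  have h2 := hMG.card_common_le M S hS 15 hd
  rw [hM] at h1 h2
  rw [← sum_card_filter_eq_card_product S (fun v u => G.Adj v u)] at h1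
  rw [← sum_card_filter_eq_card_product S
    (fun v u => v ≠ u ∧ ∃ w ∉ S, G.Adj w v ∧ G.Adj w u)] at h2
  by_contra! hcon
  have h3 : ∑ _v ∈ S, 16 * 1801 ≤
      ∑ v ∈ S, (1801 * (S.filter (fun u => G.Adj v u)).card +
        16 * (S.filter (fun u => v ≠ u ∧ ∃ w ∉ S, G.Adj w v ∧ G.Adj w u)).card) := by
    refine Finset.sum_le_sum fun v hv => ?_
    have := hcon v hv
    by_cases hv' : (S.filter (fun u => G.Adj v u)).card ≤ 15
    · have := this hv'
      omega
    · omega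
  rw [Finset.sum_add_distrib, Finset.sum_const, smul_eq_mul, ← Finset.mul_sum,
    ← Finset.mul_sum] at h3
  have := hS.card_pos
  zify at h3 hSh this
  push_cast at h1 h2
  linarith

/-! ### A random target with an extension property -/

open Classical in
/-- Counting form of independence: an event that depends on the values of a random function at
the places `p y` only has the probability that it has for a random function of `y`. -/
lemma card_filter_comp {X Y : Type*} [Fintype X] [Fintype Y] (p : Y → X)
    (hp : Function.Injective p) (P : (Y → Bool) → Prop) :
    (Finset.univ.filter (fun ω : X → Bool => P (ω ∘ p))).card * 2 ^ Fintype.card Y =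
      (Finset.univ.filter P).card * 2 ^ Fintype.card X := by
  let C := {x : X // ¬ x ∈ Set.range p}
  let e : (X → Bool) ≃ (Y → Bool) × (C → Bool) :=
    (Equiv.piEquivPiSubtypeProd (· ∈ Set.range p) fun _ => Bool).trans
      (((Equiv.ofInjective p hp).arrowCongr (Equiv.refl Bool)).symm.prodCongr (Equiv.refl _))
  have he : ∀ ω, (e ω).1 = ω ∘ p := fun ω => rfl
  have h1 : (Finset.univ.filter (fun ω : X → Bool => P (ω ∘ p))).card =
      ((Finset.univ.filter P) ×ˢ (Finset.univ : Finset (C → Bool))).card :=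
    Finset.card_equiv e fun ω => by simp [he]
  have h2 : 2 ^ Fintype.card X = 2 ^ Fintype.card Y * 2 ^ Fintype.card C := by
    have := Fintype.card_congr e
    simpa using this
  rw [h1, Finset.card_product, h2, Finset.card_univ, Fintype.card_fun, Fintype.card_bool]
  ring

open Classical in
/-- The probability that in each of the rows `j` a random 0-1 matrix differs from a given one. -/
lemma card_filter_rows_ne {J I : Type*} [Fintype J] [Fintype I] (τ : J → I → Bool) :
    (Finset.univ.filter (fun f : J × I → Bool => ∀ j, ∃ i, f (j, i) ≠ τ j i)).card =
      (2 ^ Fintype.card I - 1) ^ Fintype.card J := by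
  have h1 : (Finset.univ.filter (fun f : J × I → Bool => ∀ j, ∃ i, f (j, i) ≠ τ j i)).card =
      (Fintype.piFinset (fun j => Finset.univ.erase (τ j))).card :=
    Finset.card_equiv (Equiv.curry J I Bool) fun f => by
      simp [Fintype.mem_piFinset, Function.ne_iff]
  rw [h1, Fintype.card_piFinset]
  simp [Finset.card_erase_of_mem]

open Classical in
/-- The probabilistic construction of a target. Its vertices are a set `A`, and blocks indexed
by `K` that are copies of `J`. For all `d` vertices outside a block and all directions, some vertex
of the block is joined to these vertices by arcs in the given directions. -/
lemma exists_extension_property (A K J : Type*) [Fintype A] [Fintype K] [Fintype J] (d : ℕ)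
    (hcount : (Fintype.card K * Fintype.card (A ⊕ K × J) ^ d * 2 ^ d) *
      (2 ^ d - 1) ^ Fintype.card J < 2 ^ (Fintype.card J * d)) :
    ∃ R : OrientedGraph (A ⊕ K × J), ∀ (k : K) (q : Fin d → A ⊕ K × J), Function.Injective q →
      (∀ i j, q i ≠ Sum.inr (k, j)) → ∀ σ : Fin d → Prop,
        ∃ j, ∀ i, (σ i → R.Adj (Sum.inr (k, j)) (q i)) ∧ (¬ σ i → R.Adj (q i) (Sum.inr (k, j))) := by
  let T := A ⊕ K × J
  let r := Fintype.equivFin T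
  -- the direction in which the bit of an unordered pair has to be read
  let pat : K × (Fin d → T) × (Fin d → Bool) → J → Fin d → Bool := fun c j i =>
    if c.2.2 i then decide (r (Sum.inr (c.1, j)) < r (c.2.1 i))
    else decide (r (c.2.1 i) < r (Sum.inr (c.1, j)))
  let pos : K × (Fin d → T) × (Fin d → Bool) → J × Fin d → Sym2 T := fun c ji =>
    s(Sum.inr (c.1, ji.1), c.2.1 ji.2)
  let good : Finset (K × (Fin d → T) × (Fin d → Bool)) := Finset.univ.filter fun c =>
    Function.Injective c.2.1 ∧ ∀ i j, c.2.1 i ≠ Sum.inr (c.1, j)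
  let bad : K × (Fin d → T) × (Fin d → Bool) → Finset (Sym2 T → Bool) := fun c =>
    Finset.univ.filter fun ω => ∀ j, ∃ i, (ω ∘ pos c) (j, i) ≠ pat c j i
  have hbad : ∀ c ∈ good, (bad c).card * 2 ^ (Fintype.card J * d) =
      (2 ^ d - 1) ^ Fintype.card J * 2 ^ Fintype.card (Sym2 T) := by
    intro c hc
    obtain ⟨hc1, hc2⟩ := (Finset.mem_filter.mp hc).2
    have hpos : Function.Injective (pos c) := by
      rintro ⟨j, i⟩ ⟨j', i'⟩ h
      rcases Sym2.eq_iff.mp h with h | h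
      · have h1 : j = j' := (Prod.mk.inj (Sum.inr.inj h.1)).2
        exact Prod.ext h1 (hc1 h.2)
      · exact absurd h.2 (hc2 _ _)
    have := card_filter_comp (pos c) hpos (fun f => ∀ j, ∃ i, f (j, i) ≠ pat c j i)
    have h5 := card_filter_rows_ne (pat c)
    rw [Fintype.card_fin] at h5
    rw [Fintype.card_prod, Fintype.card_fin] at this
    rw [← h5]
    convert this
  have hex : ∃ ω : Sym2 T → Bool, ∀ c ∈ good, ω ∉ bad c := by
    by_contra! hcon
    have h1 : (Finset.univ : Finset (Sym2 T → Bool)) ⊆ good.biUnion bad := by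
      intro ω _
      obtain ⟨c, hc, hω⟩ := hcon ω
      exact Finset.mem_biUnion.mpr ⟨c, hc, hω⟩
    have h2 := (Finset.card_le_card h1).trans Finset.card_biUnion_le
    rw [Finset.card_univ, Fintype.card_fun, Fintype.card_bool] at h2
    have h3 : 2 ^ Fintype.card (Sym2 T) * 2 ^ (Fintype.card J * d) ≤
        Fintype.card (K × (Fin d → T) × (Fin d → Bool)) *
          ((2 ^ d - 1) ^ Fintype.card J * 2 ^ Fintype.card (Sym2 T)) := by
      calc _ ≤ (∑ c ∈ good, (bad c).card) * 2 ^ (Fintype.card J * d) :=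
            Nat.mul_le_mul_right _ h2
        _ = ∑ c ∈ good, (2 ^ d - 1) ^ Fintype.card J * 2 ^ Fintype.card (Sym2 T) := by
            rw [Finset.sum_mul]
            exact Finset.sum_congr rfl hbad
        _ = good.card * ((2 ^ d - 1) ^ Fintype.card J * 2 ^ Fintype.card (Sym2 T)) := by
            rw [Finset.sum_const, smul_eq_mul]
        _ ≤ _ := Nat.mul_le_mul_right _ (Finset.card_le_univ good)
    have h4 : Fintype.card (K × (Fin d → T) × (Fin d → Bool)) =
        Fintype.card K * Fintype.card T ^ d * 2 ^ d := by
      simp [mul_assoc]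
    rw [h4, ← mul_assoc, mul_comm] at h3
    exact absurd (Nat.le_of_mul_le_mul_right h3 (by positivity)) (not_le.mpr hcount)
  obtain ⟨ω, hω⟩ := hex
  refine ⟨⟨fun x y => x ≠ y ∧ ω s(x, y) = decide (r x < r y), ?_⟩, ?_⟩
  · rintro x y ⟨hne, h1⟩ ⟨-, h2⟩
    rw [Sym2.eq_swap, h1] at h2
    have hr : r x ≠ r y := fun h => hne (r.injective h)
    rcases lt_or_gt_of_ne hr with h | h
    · simp [h, h.not_gt] at h2
    · simp [h, h.not_gt] at h2
  · intro k q hq hqk σ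
    have hc : (k, q, fun i => decide (σ i)) ∈ good := by
      simp only [good, Finset.mem_filter, Finset.mem_univ, true_and]
      exact ⟨hq, hqk⟩
    have h1 := hω _ hc
    simp only [bad, Finset.mem_filter, Finset.mem_univ, true_and] at h1
    push Not at h1
    obtain ⟨j, hj⟩ := h1
    refine ⟨j, fun i => ⟨fun hi => ⟨(hqk i j).symm, ?_⟩, fun hi => ⟨hqk i j, ?_⟩⟩⟩
    · have := hj i
      simpa [pat, pos, hi] using this
    · have := hj i
      rw [Sym2.eq_swap]
      simpa [pat, pos, hi] using this

/-! ### The upper bound -/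

/-- Replaces the arcs inside the first part of the vertex set. -/
def OrientedGraph.replaceInl {A B : Type*} (R : OrientedGraph (A ⊕ B)) (H : OrientedGraph A) :
    OrientedGraph (A ⊕ B) where
  Adj
    | Sum.inl a, Sum.inl b => H.Adj a b
    | x, y => R.Adj x y
  asymm := by
    rintro (a | a) (b | b)
    · exact H.asymm a b
    · exact R.asymm _ _
    · exact R.asymm _ _
    · exact R.asymm _ _

lemma OrientedGraph.replaceInl_inr_left {A B : Type*} (R : OrientedGraph (A ⊕ B))
    (H : OrientedGraph A) (b : B) (x : A ⊕ B) :
    (R.replaceInl H).Adj (Sum.inr b) x ↔ R.Adj (Sum.inr b) x := by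
  cases x <;> rfl

lemma OrientedGraph.replaceInl_inr_right {A B : Type*} (R : OrientedGraph (A ⊕ B))
    (H : OrientedGraph A) (b : B) (x : A ⊕ B) :
    (R.replaceInl H).Adj x (Sum.inr b) ↔ R.Adj x (Sum.inr b) := by
  cases x <;> rfl

open Classical in
/-- The colouring, by induction on the set `S` of vertices that are coloured. A small set `S` is
mapped injectively to `A`, which gets the arcs of `D` there. A large set `S` has a removable vertex
`v`; colour `S \ {v}`, choose a block that contains no colour of a neighbour of `v` in `S` or of a
vertex of `S` with a common neighbour outside `S`, and in this block a colour for `v` with the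
required arcs. The vertices of `S` with a common neighbour outside `S` always have distinct
colours, so that the directions required by the neighbours of `v` do not contradict each other. -/
lemma exists_colouring_of_subset {V : Type*} {G : SimpleGraph V} (D : OrientedGraph V)
    (hD : D.underlying = G) {h : ℕ} (hG : EmbedsInGenus G h)
    {A K J : Type*} [Fintype A] [Fintype K] [Fintype J] [Nonempty J]
    (hA : 3 * h ≤ Fintype.card A) (hK : 1816 ≤ Fintype.card K) (R : OrientedGraph (A ⊕ K × J))
    (hR : ∀ (k : K) (q : Fin 15 → A ⊕ K × J), Function.Injective q →
      (∀ i j, q i ≠ Sum.inr (k, j)) → ∀ σ : Fin 15 → Prop,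
        ∃ j, ∀ i, (σ i → R.Adj (Sum.inr (k, j)) (q i)) ∧ (¬ σ i → R.Adj (q i) (Sum.inr (k, j))))
    (n : ℕ) : ∀ S : Finset V, S.card = n →
      (∀ w ∉ S, (S.filter (fun u => G.Adj w u)).card ≤ 15) →
      ∃ (H : OrientedGraph A) (φ : V → A ⊕ K × J),
        (∀ u ∈ S, ∀ v ∈ S, D.Adj u v → (R.replaceInl H).Adj (φ u) (φ v)) ∧
        ∀ w ∉ S, ∀ u ∈ S, ∀ v ∈ S, G.Adj w u → G.Adj w v → φ u = φ v → u = v := by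
  have hDG : ∀ {u v}, D.Adj u v → G.Adj u v := fun h => hD ▸ Or.inl h
  have hDG' : ∀ {u v}, G.Adj u v → D.Adj u v ∨ D.Adj v u := fun h => by
    subst hD
    exact h
  induction n with
  | zero =>
    intro S hS _
    obtain rfl := Finset.card_eq_zero.mp hS
    have : Nonempty K := Fintype.card_pos_iff.mp (by omega)
    exact ⟨⟨fun _ _ => False, fun _ _ h => h.elim⟩, fun _ => Sum.inr (Classical.arbitrary _),
      by simp, by simp⟩
  | succ n ih =>
    intro S hS hdeg
    by_cases hSA : S.card ≤ Fintype.card A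
    · obtain ⟨ι⟩ := Function.Embedding.nonempty_of_card_le (α := S) (β := A)
        (by rwa [Fintype.card_coe])
      have : Nonempty K := Fintype.card_pos_iff.mp (by omega)
      let φ : V → A ⊕ K × J := fun v =>
        if hv : v ∈ S then Sum.inl (ι ⟨v, hv⟩) else Sum.inr (Classical.arbitrary _)
      have hφ : ∀ v (hv : v ∈ S), φ v = Sum.inl (ι ⟨v, hv⟩) := fun v hv => dif_pos hv
      refine ⟨⟨fun a b => ∃ u v : S, ι u = a ∧ ι v = b ∧ D.Adj u v, ?_⟩, φ, ?_, ?_⟩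
      · rintro _ _ ⟨u, v, rfl, rfl, huv⟩ ⟨v', u', hv, hu, huv'⟩
        obtain rfl := ι.injective hv
        obtain rfl := ι.injective hu
        exact D.asymm _ _ huv huv'
      · intro u hu v hv huv
        rw [hφ u hu, hφ v hv]
        exact ⟨⟨u, hu⟩, ⟨v, hv⟩, rfl, rfl, huv⟩
      · intro w _ u hu v hv _ _ huv
        rw [hφ u hu, hφ v hv] at huv
        exact congrArg Subtype.val (ι.injective (Sum.inl_injective huv))
    · have hSne : S.Nonempty := Finset.card_pos.mp (by omega)
      obtain ⟨v, hv, hv1, hv2⟩ := hG.exists_removable S hSne (by omega) hdeg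
      obtain ⟨H, φ, hφ1, hφ2⟩ := ih (S.erase v)
        (by rw [Finset.card_erase_of_mem hv, hS, Nat.add_sub_cancel]) (by
          intro w hw
          by_cases hwS : w ∈ S
          · obtain rfl : w = v := by
              by_contra hne
              exact hw (Finset.mem_erase.mpr ⟨hne, hwS⟩)
            exact (Finset.card_le_card (Finset.filter_subset_filter _
              (Finset.erase_subset _ _))).trans hv1
          · exact (Finset.card_le_card (Finset.filter_subset_filter _
              (Finset.erase_subset _ _))).trans (hdeg w hwS))
      set N := S.filter (fun u => G.Adj v u) with hN
      set C := S.filter (fun u => v ≠ u ∧ ∃ w ∉ S, G.Adj w v ∧ G.Adj w u) with hC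
      have hvS : v ∉ S.erase v := Finset.notMem_erase v S
      have hNS : ∀ u ∈ N, u ∈ S.erase v ∧ G.Adj v u := by
        intro u hu
        obtain ⟨h1, h2⟩ := Finset.mem_filter.mp hu
        exact ⟨Finset.mem_erase.mpr ⟨h2.ne', h1⟩, h2⟩
      let block : A ⊕ K × J → Option K := Sum.elim (fun _ => none) (fun x => some x.1)
      obtain ⟨k, hk⟩ : ∃ k : K, ∀ u ∈ N ∪ C, block (φ u) ≠ some k := by
        by_contra! hcon
        have h1 : (Finset.univ.image (some : K → Option K)) ⊆
            (N ∪ C).image (fun u => block (φ u)) := by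
          intro x hx
          obtain ⟨k, -, rfl⟩ := Finset.mem_image.mp hx
          obtain ⟨u, hu, huk⟩ := hcon k
          exact Finset.mem_image.mpr ⟨u, hu, huk⟩
        have h2 := Finset.card_le_card h1
        rw [Finset.card_image_of_injective _ (Option.some_injective K), Finset.card_univ] at h2
        have h3 := h2.trans Finset.card_image_le
        have h4 := h3.trans (Finset.card_union_le N C)
        omega
      obtain ⟨Q, hQ1, hQ2, hQ3⟩ := Finset.exists_subsuperset_card_eq
        (s := N.image φ) (t := Finset.univ.filter (fun x => block x ≠ some k)) (n := 15)
        (by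
          intro x hx
          obtain ⟨u, hu, rfl⟩ := Finset.mem_image.mp hx
          simpa using hk u (Finset.mem_union_left _ hu))
        (Finset.card_image_le.trans hv1)
        (by
          have h1 : ((Finset.univ.erase k).image
              (fun k' => (Sum.inr (k', Classical.arbitrary J) : A ⊕ K × J))).card =
              Fintype.card K - 1 := by
            rw [Finset.card_image_of_injective, Finset.card_erase_of_mem (Finset.mem_univ k),
              Finset.card_univ]
            intro a b hab
            exact (Prod.mk.inj (Sum.inr_injective hab)).1
          have h2 : 15 ≤ Fintype.card K - 1 := by omega
          rw [← h1] at h2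
          refine h2.trans (Finset.card_le_card ?_)
          intro x hx
          obtain ⟨k', hk', rfl⟩ := Finset.mem_image.mp hx
          simpa [block] using Finset.ne_of_mem_erase hk')
      let q : Fin 15 → A ⊕ K × J := fun i => ((Finset.equivFinOfCardEq hQ3).symm i).1
      have hq : ∀ u ∈ N, ∃ i, q i = φ u := by
        intro u hu
        exact ⟨Finset.equivFinOfCardEq hQ3 ⟨φ u, hQ1 (Finset.mem_image_of_mem φ hu)⟩, by simp [q]⟩
      obtain ⟨j, hj⟩ := hR k q
        (fun i i' hii => (Finset.equivFinOfCardEq hQ3).symm.injective (Subtype.ext hii))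
        (by
          intro i j hij
          have h1 := hQ2 ((Finset.equivFinOfCardEq hQ3).symm i).2
          have h2 : block (q i) ≠ some k := (Finset.mem_filter.mp h1).2
          rw [hij] at h2
          exact h2 rfl)
        (fun i => ∃ u ∈ N, φ u = q i ∧ D.Adj v u)
      have hupd : ∀ u ∈ S, u ≠ v →
          u ∈ S.erase v ∧ Function.update φ v (Sum.inr (k, j)) u = φ u :=
        fun u hu huv => ⟨Finset.mem_erase.mpr ⟨huv, hu⟩, Function.update_of_ne huv _ _⟩
      have hnew : ∀ w ∉ S, ∀ u ∈ S, u ≠ v → G.Adj w v → G.Adj w u →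
          φ u ≠ Sum.inr (k, j) := by
        intro w hw u hu huv hwv hwu heq
        have huC : u ∈ C := Finset.mem_filter.mpr ⟨hu, huv.symm, w, hw, hwv, hwu⟩
        have := hk u (Finset.mem_union_right _ huC)
        rw [heq] at this
        exact this rfl
      refine ⟨H, Function.update φ v (Sum.inr (k, j)), ?_, ?_⟩
      · intro u₁ hu₁ u₂ hu₂ hadj
        by_cases h1 : u₁ = v
        · subst h1
          have h2 : u₂ ≠ u₁ := (hDG hadj).ne'
          rw [Function.update_self, (hupd u₂ hu₂ h2).2, R.replaceInl_inr_left]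
          have hu₂N : u₂ ∈ N := Finset.mem_filter.mpr ⟨hu₂, hDG hadj⟩
          obtain ⟨i, hi⟩ := hq u₂ hu₂N
          rw [← hi]
          exact (hj i).1 ⟨u₂, hu₂N, hi.symm, hadj⟩
        · rw [(hupd u₁ hu₁ h1).2]
          by_cases h2 : u₂ = v
          · subst h2
            rw [Function.update_self, R.replaceInl_inr_right]
            have hu₁N : u₁ ∈ N := Finset.mem_filter.mpr ⟨hu₁, (hDG hadj).symm⟩
            obtain ⟨i, hi⟩ := hq u₁ hu₁N
            rw [← hi]
            refine (hj i).2 ?_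
            rintro ⟨u, hu, hui, huadj⟩
            obtain rfl := hφ2 u₂ hvS u (hNS u hu).1 u₁ (hNS u₁ hu₁N).1 (hNS u hu).2
              (hNS u₁ hu₁N).2 (hui.trans hi)
            exact D.asymm _ _ hadj huadj
          · rw [(hupd u₂ hu₂ h2).2]
            exact hφ1 u₁ (hupd u₁ hu₁ h1).1 u₂ (hupd u₂ hu₂ h2).1 hadj
      · intro w hw u₁ hu₁ u₂ hu₂ hw₁ hw₂ heq
        by_cases h1 : u₁ = v
        · by_cases h2 : u₂ = v
          · rw [h1, h2]
          · subst h1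
            rw [Function.update_self, (hupd u₂ hu₂ h2).2] at heq
            exact absurd heq.symm (hnew w hw u₂ hu₂ h2 hw₁ hw₂)
        · rw [(hupd u₁ hu₁ h1).2] at heq
          by_cases h2 : u₂ = v
          · subst h2
            rw [Function.update_self] at heq
            exact absurd heq (hnew w hw u₁ hu₁ h1 hw₂ hw₁)
          · rw [(hupd u₂ hu₂ h2).2] at heq
            exact hφ2 w (fun h => hw (Finset.mem_of_mem_erase h)) u₁ (hupd u₁ hu₁ h1).1 u₂
              (hupd u₂ hu₂ h2).1 hw₁ hw₂ heq

lemma OrientedGraph.Colourable.of_hom {V T : Type*} [Fintype T] {D : OrientedGraph V}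
    {H : OrientedGraph T} {φ : V → T} (hφ : IsOrientedHom D H φ) :
    D.Colourable (Fintype.card T) := by
  let e := Fintype.equivFin T
  refine ⟨Fintype.card T, ⟨fun x y => H.Adj (e.symm x) (e.symm y), fun x y => H.asymm _ _⟩,
    e ∘ φ, le_rfl, ?_⟩
  intro u v huv
  simpa using hφ u v huv

/-- `(1 + 1 / N) ^ (N + 1) ≥ 2`. -/
lemma two_mul_pow_succ_le (N : ℕ) : 2 * N ^ (N + 1) ≤ (N + 1) ^ (N + 1) := by
  rw [add_pow, Finset.sum_range_succ, Finset.sum_range_succ]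
  simp only [one_pow, mul_one, Nat.choose_self, Nat.cast_one, Nat.choose_succ_self_right,
    Nat.cast_id]
  have : N ^ (N + 1) ≤ N ^ N * (N + 1) := by
    rw [pow_succ]
    exact Nat.mul_le_mul_left _ (Nat.le_succ N)
  omega

/-- The union bound of `exists_extension_property` for the numbers that are used. -/
lemma union_bound (N g b T : ℕ) (hg : 1 ≤ g) (hN : N + 1 = 2 ^ 15)
    (hb : b = (N + 1) * (2 ^ 13 * g)) (hT : T ≤ 2 ^ 40 * g) :
    (2048 * T ^ 15 * 2 ^ 15) * N ^ b < 2 ^ (b * 15) := by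
  have h1 : T ≤ 2 ^ (40 + g) := by
    rw [pow_add]
    exact hT.trans (Nat.mul_le_mul_left _ Nat.lt_two_pow_self.le)
  have h2 : 2048 * T ^ 15 * 2 ^ 15 ≤ 2 ^ (626 + 15 * g) := by
    calc 2048 * T ^ 15 * 2 ^ 15 ≤ 2 ^ 11 * (2 ^ (40 + g)) ^ 15 * 2 ^ 15 := by gcongr; norm_num
      _ = 2 ^ (626 + 15 * g) := by
        rw [← pow_mul, ← pow_add, ← pow_add]
        congr 1
        ring
  have h3 : 2 ^ (2 ^ 13 * g) * N ^ b ≤ 2 ^ (b * 15) := by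
    calc 2 ^ (2 ^ 13 * g) * N ^ b = (2 * N ^ (N + 1)) ^ (2 ^ 13 * g) := by
          rw [hb, mul_pow, ← pow_mul]
      _ ≤ ((N + 1) ^ (N + 1)) ^ (2 ^ 13 * g) := Nat.pow_le_pow_left (two_mul_pow_succ_le N) _
      _ = (N + 1) ^ b := by rw [hb, ← pow_mul]
      _ = 2 ^ (b * 15) := by rw [hN, ← pow_mul, mul_comm]
  have hNpos : 0 < N := by omega
  refine lt_of_lt_of_le ?_ h3
  refine Nat.mul_lt_mul_of_pos_right (h2.trans_lt ?_) (by positivity)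
  exact Nat.pow_lt_pow_right (by norm_num) (by omega)

/-- The linear upper bound for the oriented chromatic number. -/
lemma EmbedsInGenus.colourable {V : Type*} [Finite V] {G : SimpleGraph V} (D : OrientedGraph V)
    (hD : D.underlying = G) {h g : ℕ} (hG : EmbedsInGenus G h) (hhg : h ≤ g) (hg : 1 ≤ g) :
    D.Colourable (2 ^ 40 * g) := by
  classical
  have := Fintype.ofFinite V
  obtain ⟨b, hb⟩ : ∃ b, b = (2 ^ 15 - 1 + 1) * (2 ^ 13 * g) := ⟨_, rfl⟩
  have hcard : Fintype.card (Fin (3 * g) ⊕ Fin 2048 × Fin b) = 3 * g + 2048 * b := by simp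
  have hT : Fintype.card (Fin (3 * g) ⊕ Fin 2048 × Fin b) ≤ 2 ^ 40 * g := by
    rw [hcard, hb]
    norm_num
    omega
  have : Nonempty (Fin b) := ⟨⟨0, by
    rw [hb]
    positivity⟩⟩
  obtain ⟨R, hR⟩ := exists_extension_property (Fin (3 * g)) (Fin 2048) (Fin b) 15 (by
    rw [Fintype.card_fin, Fintype.card_fin]
    exact union_bound (2 ^ 15 - 1) g b _ hg (by norm_num) hb hT)
  obtain ⟨H, φ, hφ, -⟩ := exists_colouring_of_subset D hD hG
    (by rw [Fintype.card_fin]; omega) (by simp) R hR _ Finset.univ rfl (by simp)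
  obtain ⟨m, H', φ', hm, hφ'⟩ := OrientedGraph.Colourable.of_hom (D := D)
    (H := R.replaceInl H) (φ := φ)
    (fun u v huv => hφ u (Finset.mem_univ _) v (Finset.mem_univ _) huv)
  exact ⟨m, H', φ', hm.trans hT, hφ'⟩

/-! ### Complete bipartite graphs -/

namespace CellEmbedding

/-- Renaming of the flags. -/
def map {F F' : Type*} (M : CellEmbedding F) (e : F ≃ F') : CellEmbedding F' where
  τ₀ x := e (M.τ₀ (e.symm x))
  τ₁ x := e (M.τ₁ (e.symm x))
  τ₂ x := e (M.τ₂ (e.symm x))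
  invol₀ x := by simp [M.invol₀]
  invol₁ x := by simp [M.invol₁]
  invol₂ x := by simp [M.invol₂]
  ne₀ x := by
    rw [Ne, ← Equiv.eq_symm_apply]
    exact M.ne₀ _
  ne₁ x := by
    rw [Ne, ← Equiv.eq_symm_apply]
    exact M.ne₁ _
  ne₂ x := by
    rw [Ne, ← Equiv.eq_symm_apply]
    exact M.ne₂ _
  comm x := by simp [M.comm]
  ne₀₂ x := by
    rw [Ne, ← Equiv.eq_symm_apply, Equiv.symm_apply_apply]
    exact M.ne₀₂ _
  nonempty := M.nonempty.map e
  connected x y := by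
    have h := Relation.ReflTransGen.lift (p := fun a b => b = e (M.τ₀ (e.symm a)) ∨
      b = e (M.τ₁ (e.symm a)) ∨ b = e (M.τ₂ (e.symm a))) e (by
        intro a b h
        simpa [Function.onFun] using h) _ _ (M.connected (e.symm x) (e.symm y))
    simpa only [Function.onFun, Equiv.apply_symm_apply] using h

variable {F F' : Type*} (M : CellEmbedding F) (e : F ≃ F')

/-- The vertices after a renaming of the flags. -/
def mapVertex : M.Vertex ≃ (M.map e).Vertex := Quot.congr e (by simp [map])

lemma mapVertex_vertexOf (x : F) : M.mapVertex e (M.vertexOf x) = (M.map e).vertexOf (e x) := rfl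

lemma eulerGenus_map : (M.map e).eulerGenus = M.eulerGenus := by
  have h1 : Nat.card (M.map e).Edge = Nat.card M.Edge :=
    Nat.card_congr (Quot.congr e (by simp [map])).symm
  have h2 : Nat.card (M.map e).Face = Nat.card M.Face :=
    Nat.card_congr (Quot.congr e (by simp [map])).symm
  rw [eulerGenus, eulerGenus, h1, h2, Nat.card_congr (M.mapVertex e).symm]

lemma Contains.map {V : Type*} {G : SimpleGraph V} (h : M.Contains G) :
    (M.map e).Contains G := by
  obtain ⟨φ, hφ, hadj⟩ := h
  refine ⟨fun v => M.mapVertex e (φ v), (M.mapVertex e).injective.comp hφ, fun u v huv => ?_⟩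
  obtain ⟨x, hx1, hx2⟩ := hadj u v huv
  refine ⟨e x, ?_, ?_⟩
  · exact (M.mapVertex_vertexOf e x).symm.trans (congrArg _ hx1)
  · have h : (M.map e).τ₀ (e x) = e (M.τ₀ x) := by simp [CellEmbedding.map]
    rw [h]
    exact (M.mapVertex_vertexOf e _).symm.trans (congrArg _ hx2)

lemma Contains.embedsInGenus [Finite F] {V : Type*} {G : SimpleGraph V} (h : M.Contains G) {g : ℕ}
    (hg : M.eulerGenus ≤ g) : ∃ k ≤ g, EmbedsInGenus G k := by
  obtain ⟨k, hk⟩ := Int.eq_ofNat_of_zero_le M.eulerGenus_nonneg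
  refine ⟨k, by omega, _, M.map (Finite.equivFin F), ?_, Contains.map M _ h⟩
  rw [eulerGenus_map, hk]

end CellEmbedding

lemma zmod_eq_of_add_one {n : ℕ} [NeZero n] {α : Type*} (f : ZMod n → α)
    (hf : ∀ j, f (j + 1) = f j) (i j : ZMod n) : f i = f j := by
  have h : ∀ k : ℕ, f k = f 0 := by
    intro k
    induction k with
    | zero => simp
    | succ k ih => rw [Nat.cast_succ, hf, ih]
  rw [← ZMod.natCast_zmod_val i, ← ZMod.natCast_zmod_val j, h, h]

/-- The complete bipartite graph on `Fin m` and `Fin n`; the arcs between `i` and `v` have the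
direction given by the binary digit of `v` at the place `i`. -/
def binaryOrientation (m n : ℕ) : OrientedGraph (Fin m ⊕ Fin n) where
  Adj
    | Sum.inl i, Sum.inr v => v.1.testBit i = true
    | Sum.inr v, Sum.inl i => v.1.testBit i = false
    | _, _ => False
  asymm := by
    rintro (i | v) (j | w) h h'
    · exact h
    · exact Bool.noConfusion (h.symm.trans h')
    · exact Bool.noConfusion (h.symm.trans h')
    · exact h

/-- Any two numbers below `2 ^ m` are joined by a directed path of length two through a place at
which their digits differ. -/
lemma le_of_colourable_binaryOrientation {m n k : ℕ} (hn : n ≤ 2 ^ m)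
    (h : (binaryOrientation m n).Colourable k) : n ≤ k := by
  obtain ⟨c, H, φ, hc, hφ⟩ := h
  have hinj : Function.Injective fun v : Fin n => φ (Sum.inr v) := by
    intro v w hvw
    by_contra hne
    have hne' : v.1 ≠ w.1 := fun h => hne (Fin.ext h)
    obtain ⟨i, hi⟩ := Nat.exists_testBit_ne_of_ne hne'
    have him : i < m := by
      by_contra him
      have hlt : ∀ u : Fin n, u.1 < 2 ^ i := fun u =>
        u.2.trans_le (hn.trans (Nat.pow_le_pow_right (by norm_num) (not_lt.mp him)))
      exact hi ((Nat.testBit_lt_two_pow (hlt v)).trans (Nat.testBit_lt_two_pow (hlt w)).symm)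
    have h1 : ∀ u : Fin n, u.1.testBit i = true →
        H.Adj (φ (Sum.inl ⟨i, him⟩)) (φ (Sum.inr u)) :=
      fun u hu => hφ (Sum.inl ⟨i, him⟩) (Sum.inr u) hu
    have h2 : ∀ u : Fin n, u.1.testBit i = false →
        H.Adj (φ (Sum.inr u)) (φ (Sum.inl ⟨i, him⟩)) :=
      fun u hu => hφ (Sum.inr u) (Sum.inl ⟨i, him⟩) hu
    simp only at hvw
    cases hv : v.1.testBit i <;> cases hw : w.1.testBit i
    · exact hi (hv.trans hw.symm)
    · exact H.asymm _ _ (h2 v hv) (hvw ▸ h1 w hw)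
    · exact H.asymm _ _ (h1 v hv) (hvw ▸ h2 w hw)
    · exact hi (hv.trans hw.symm)
  have := Fintype.card_le_of_injective _ hinj
  simp only [Fintype.card_fin] at this
  omega

section Bipartite

variable (m n : ℕ) [NeZero m] [NeZero n]

/-- An embedding of the complete bipartite graph on `ZMod m` and `ZMod n` in an orientable
surface. The flags are an edge `(i, j)`, an end (`false` for `i`, `true` for `j`) and a side; the
edges around every vertex are in cyclic order. -/
def completeBipartiteEmbedding : CellEmbedding ((ZMod m × ZMod n) × Bool × Bool) where
  τ₀ x := (x.1, !x.2.1, x.2.2)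
  τ₁
    | ((i, j), false, false) => ((i, j - 1), false, true)
    | ((i, j), false, true) => ((i, j + 1), false, false)
    | ((i, j), true, false) => ((i - 1, j), true, true)
    | ((i, j), true, true) => ((i + 1, j), true, false)
  τ₂ x := (x.1, x.2.1, !x.2.2)
  invol₀ x := by simp
  invol₁ := by
    rintro ⟨⟨i, j⟩, (_ | _), (_ | _)⟩ <;> simp
  invol₂ x := by simp
  ne₀ := by
    rintro ⟨⟨i, j⟩, (_ | _), t⟩ <;> simp
  ne₁ := by
    rintro ⟨⟨i, j⟩, (_ | _), (_ | _)⟩ <;> simp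
  ne₂ := by
    rintro ⟨⟨i, j⟩, s, (_ | _)⟩ <;> simp
  comm x := rfl
  ne₀₂ := by
    rintro ⟨⟨i, j⟩, (_ | _), t⟩ <;> simp
  nonempty := ⟨((0, 0), false, false)⟩
  connected := by
    intro x
    set τ₁ : (ZMod m × ZMod n) × Bool × Bool → (ZMod m × ZMod n) × Bool × Bool := fun
    | ((i, j), false, false) => ((i, j - 1), false, true)
    | ((i, j), false, true) => ((i, j + 1), false, false)
    | ((i, j), true, false) => ((i - 1, j), true, true)
    | ((i, j), true, true) => ((i + 1, j), true, false) with hτ₁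
    let c : (ZMod m × ZMod n) × Bool × Bool → Prop := fun y => Relation.ReflTransGen
      (fun a b => b = (a.1, !a.2.1, a.2.2) ∨ b = τ₁ a ∨ b = (a.1, a.2.1, !a.2.2)) x y
    have h0 : ∀ y, c y → c (y.1, !y.2.1, y.2.2) := fun y hy => hy.tail (Or.inl rfl)
    have h1 : ∀ y, c y → c (τ₁ y) := fun y hy => hy.tail (Or.inr (Or.inl rfl))
    have h2 : ∀ y, c y → c (y.1, y.2.1, !y.2.2) := fun y hy => hy.tail (Or.inr (Or.inr rfl))
    have h0' : ∀ p s t, c (p, s, t) = c (p, false, t) := by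
      rintro p (_ | _) t
      · rfl
      · exact propext ⟨h0 (p, true, t), h0 (p, false, t)⟩
    have h2' : ∀ p s t, c (p, s, t) = c (p, s, false) := by
      rintro p s (_ | _)
      · rfl
      · exact propext ⟨h2 (p, s, true), h2 (p, s, false)⟩
    have hj : ∀ i j j', c ((i, j), false, false) = c ((i, j'), false, false) := by
      intro i
      refine zmod_eq_of_add_one (fun j => c ((i, j), false, false)) fun j => ?_
      rw [← h2' (i, j) false true]
      refine propext ⟨fun h => ?_, fun h => h1 _ h⟩
      have := h1 _ h
      simpa [hτ₁] using this
    have hi : ∀ j i i', c ((i, j), true, false) = c ((i', j), true, false) := by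
      intro j
      refine zmod_eq_of_add_one (fun i => c ((i, j), true, false)) fun i => ?_
      rw [← h2' (i, j) true true]
      refine propext ⟨fun h => ?_, fun h => h1 _ h⟩
      have := h1 _ h
      simpa [hτ₁] using this
    have hall : ∀ y, c y = c ((0, 0), false, false) := by
      rintro ⟨⟨i, j⟩, s, t⟩
      rw [h2', h0', hj i j 0, ← h0' _ true, hi 0 i 0, h0']
    intro y
    have : c y := by
      rw [hall y, ← hall x]
    exact this

/-- The vertex of the complete bipartite graph to which a vertex of the embedding belongs. -/
def bipartiteVertex : (completeBipartiteEmbedding m n).Vertex → ZMod m ⊕ ZMod n :=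
  Quot.lift (fun x => if x.2.1 then Sum.inr x.1.2 else Sum.inl x.1.1) (by
    rintro ⟨⟨i, j⟩, (_ | _), (_ | _)⟩ b (rfl | rfl) <;> simp [completeBipartiteEmbedding])

lemma completeBipartiteEmbedding_eulerGenus_le :
    (completeBipartiteEmbedding m n).eulerGenus ≤ (m - 1) * (n - 1) := by
  set M := completeBipartiteEmbedding m n with hM
  have hV : m + n ≤ Nat.card M.Vertex := by
    have hf : Function.Surjective (bipartiteVertex m n) := by
      rintro (i | j)
      · exact ⟨M.vertexOf ((i, 0), false, false), rfl⟩
      · exact ⟨M.vertexOf ((0, j), true, false), rfl⟩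
    have := Nat.card_le_card_of_surjective _ hf
    simpa using this
  have hE : Nat.card M.Edge ≤ m * n := by
    let f : ZMod m × ZMod n → M.Edge := fun p => M.edgeOf (p, false, false)
    have hf : Function.Surjective f := by
      intro e
      obtain ⟨⟨p, s, t⟩, rfl⟩ := M.exists_edgeOf e
      have h0 : ∀ t, M.edgeOf (p, true, t) = M.edgeOf (p, false, t) := fun t =>
        M.edgeOf_τ₀ (p, false, t)
      have h2 : ∀ s, M.edgeOf (p, s, true) = M.edgeOf (p, s, false) := fun s =>
        M.edgeOf_τ₂ (p, s, false)
      refine ⟨p, ?_⟩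
      cases s <;> cases t <;> simp [f, h0, h2]
    have := Nat.card_le_card_of_surjective f hf
    simpa using this
  have hF : 0 < Nat.card M.Face := by
    have : Nonempty M.Face := ⟨M.faceOf ((0, 0), false, false)⟩
    exact Nat.card_pos
  rw [CellEmbedding.eulerGenus]
  zify at hV hE hF
  linarith

lemma completeBipartiteEmbedding_contains :
    (completeBipartiteEmbedding m n).Contains (binaryOrientation m n).underlying := by
  set M := completeBipartiteEmbedding m n with hM
  let eₘ : Fin m ≃ ZMod m := Fintype.equivOfCardEq (by simp)
  let eₙ : Fin n ≃ ZMod n := Fintype.equivOfCardEq (by simp)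
  have hl : ∀ i j t, M.vertexOf ((i, j), false, t) = M.vertexOf ((i, 0), false, false) := by
    intro i j t
    have h2 : ∀ j t, M.vertexOf ((i, j), false, t) = M.vertexOf ((i, j), false, false) := by
      rintro j (_ | _)
      · rfl
      · exact M.vertexOf_τ₂ ((i, j), false, false)
    rw [h2]
    refine zmod_eq_of_add_one (fun j => M.vertexOf ((i, j), false, false)) (fun j => ?_) j 0
    exact (M.vertexOf_τ₁ ((i, j), false, true)).trans (h2 j true)
  have hr : ∀ i j t, M.vertexOf ((i, j), true, t) = M.vertexOf ((0, j), true, false) := by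
    intro i j t
    have h2 : ∀ i t, M.vertexOf ((i, j), true, t) = M.vertexOf ((i, j), true, false) := by
      rintro i (_ | _)
      · rfl
      · exact M.vertexOf_τ₂ ((i, j), true, false)
    rw [h2]
    refine zmod_eq_of_add_one (fun i => M.vertexOf ((i, j), true, false)) (fun i => ?_) i 0
    exact (M.vertexOf_τ₁ ((i, j), true, true)).trans (h2 i true)
  let φ : Fin m ⊕ Fin n → M.Vertex :=
    Sum.elim (fun i => M.vertexOf ((eₘ i, 0), false, false))
      (fun j => M.vertexOf ((0, eₙ j), true, false))
  have hφ : ∀ v, bipartiteVertex m n (φ v) = Sum.map eₘ eₙ v := by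
    rintro (i | j) <;> rfl
  refine ⟨φ, ?_, ?_⟩
  · intro u v huv
    have := congrArg (bipartiteVertex m n) huv
    rw [hφ, hφ] at this
    exact (Function.Injective.sumMap eₘ.injective eₙ.injective) this
  · rintro (i | j) (i' | j') h
    · exact h.elim (fun h => h.elim) (fun h => h.elim)
    · exact ⟨((eₘ i, eₙ j'), false, false), hl _ _ _, hr _ _ _⟩
    · exact ⟨((eₘ i', eₙ j), true, false), hr _ _ _, hl _ _ _⟩
    · exact h.elim (fun h => h.elim) (fun h => h.elim)

end Bipartite

/-! ### The bounds for the maximum -/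

lemma le_chromaticNumber_iff {V : Type*} {D : OrientedGraph V} {n : ℕ∞} :
    n ≤ D.chromaticNumber ↔ ∀ k, D.Colourable k → n ≤ k := by
  simp [OrientedGraph.chromaticNumber]

lemma exists_embedsInGenus {V : Type*} {G : SimpleGraph V} {g : ℕ}
    (h : graphEulerGenus G ≤ (g : ℕ∞)) : ∃ k ≤ g, EmbedsInGenus G k := by
  by_contra! hcon
  have h1 : ((g + 1 : ℕ) : ℕ∞) ≤ graphEulerGenus G := by
    refine le_iInf₂ fun k hk => ?_
    have : g < k := by
      by_contra hle
      exact hcon k (not_lt.mp hle) hk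
    exact_mod_cast this
  have h2 : ((g + 1 : ℕ) : ℕ∞) ≤ g := h1.trans h
  have h3 : g + 1 ≤ g := by exact_mod_cast h2
  omega

lemma chiO_le {g : ℕ} (hg : 1 ≤ g) : chiO g ≤ ((2 ^ 40 * g : ℕ) : ℕ∞) := by
  refine sSup_le ?_
  rintro _ ⟨n, G, hG, rfl⟩
  obtain ⟨k, hk, hGk⟩ := exists_embedsInGenus hG
  exact iSup₂_le fun D hD => iInf₂_le _ (hGk.colourable D hD hk hg)

/-- An embedded graph all of whose colourings have at least `n` colours bounds `chiO` from
below. -/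
lemma le_chiO_of_underlying {V : Type*} [Finite V] (D : OrientedGraph V) {g n : ℕ}
    (hD : ∃ k ≤ g, EmbedsInGenus D.underlying k) (hn : ∀ k, D.Colourable k → n ≤ k) :
    (n : ℕ∞) ≤ chiO g := by
  let e := Finite.equivFin V
  let D' : OrientedGraph (Fin (Nat.card V)) :=
    ⟨fun x y => D.Adj (e.symm x) (e.symm y), fun x y => D.asymm _ _⟩
  obtain ⟨k, hk, m, M, hM, φ, hφ, hadj⟩ := hD
  have hmem : orientedChromaticNumber D'.underlying ∈ orientedChromaticNumbers g := by
    refine ⟨_, D'.underlying, ?_, rfl⟩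
    have h1 : EmbedsInGenus D'.underlying k :=
      ⟨m, M, hM, φ ∘ e.symm, hφ.comp e.symm.injective, fun u v huv => hadj _ _ huv⟩
    exact (iInf₂_le k h1).trans (by exact_mod_cast hk)
  refine le_trans ?_ (le_sSup hmem)
  refine le_trans ?_ (le_iSup₂ (f := fun D (_ : D.underlying = D'.underlying) =>
    D.chromaticNumber) D' rfl)
  rw [le_chromaticNumber_iff]
  rintro c ⟨c', H, ψ, hc, hψ⟩
  have := hn c ⟨c', H, ψ ∘ e, hc, fun u v huv => hψ (e u) (e v) (by simpa [D'] using huv)⟩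
  exact_mod_cast this

/-- The lower bound from the complete bipartite graph `K_{m,n}`, which has Euler genus at most
`(m - 1) * (n - 1)`. -/
lemma le_chiO {g m n : ℕ} (hm : 1 ≤ m) (hn : 1 ≤ n) (hnm : n ≤ 2 ^ m)
    (hg : (m - 1) * (n - 1) ≤ g) : (n : ℕ∞) ≤ chiO g := by
  have : NeZero m := ⟨by omega⟩
  have : NeZero n := ⟨by omega⟩
  refine le_chiO_of_underlying (binaryOrientation m n)
    ((completeBipartiteEmbedding_contains m n).embedsInGenus _ ?_)
    (fun k hk => le_of_colourable_binaryOrientation hnm hk)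
  refine (completeBipartiteEmbedding_eulerGenus_le m n).trans ?_
  zify [hm, hn] at hg
  exact hg

lemma chiO_mem {g : ℕ} (hg : 1 ≤ g) : chiO g ∈ orientedChromaticNumbers g ∧ chiO g ≠ ⊤ := by
  have hlt : chiO g < ⊤ := (chiO_le hg).trans_lt (ENat.natCast_lt_top _)
  have hne : (orientedChromaticNumbers g).Nonempty := by
    by_contra hempty
    rw [Set.not_nonempty_iff_eq_empty] at hempty
    have h1 : ((1 : ℕ) : ℕ∞) ≤ chiO g := le_chiO (m := 1) le_rfl le_rfl (by norm_num) (by simp)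
    rw [chiO, hempty, sSup_empty] at h1
    simp at h1
  have := hne.to_subtype
  exact ⟨ENat.sSup_mem_of_nonempty_of_lt_top hlt, hlt.ne⟩

open Real in
/-- The tangent to the logarithm at `c`, as a lower bound. -/
lemma log_tangent_le {c y : ℝ} (hc : 0 < c) (hy : 0 < y) : log c + 1 - c / y ≤ log y := by
  have h := one_sub_inv_le_log_of_pos (div_pos hy hc)
  rw [log_div hy.ne' hc.ne', inv_div] at h
  linarith

open Real in
/-- Sizes of a complete bipartite graph: `n` is at least `2 y / log y` for
`y = log 2 * (g - 1) / 2`, and `m` is the logarithm of `n` to base two, rounded up. Then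
`(m - 1) (n - 1) ≤ (log y / log 2) (2 y / log y) = g - 1` as soon as `n ≤ y`, which holds for
`g ≥ 29`; smaller `g` have individual choices. -/
lemma exists_bipartite_sizes {g : ℕ} (hg : 11 ≤ g) {y : ℝ} (hy : y = log 2 * (g - 1) / 2) :
    1 < y ∧ ∃ m n : ℕ, 1 ≤ m ∧ 1 ≤ n ∧ n ≤ 2 ^ m ∧ (m - 1) * (n - 1) ≤ g ∧
      2 * y / log y ≤ n := by
  have hl1 := log_two_gt_d9
  have hl2 := log_two_lt_d9
  have hgR : (11 : ℝ) ≤ g := by exact_mod_cast hg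
  have hy1 : 1 < y := by
    rw [hy]
    nlinarith
  have hy0 : 0 < y := by linarith
  have hlogpos : 0 < log y := log_pos hy1
  refine ⟨hy1, ?_⟩
  have hlog4 : log 4 = 2 * log 2 := by
    rw [show (4 : ℝ) = 2 ^ 2 by norm_num, log_pow]
    norm_num
  have hlog8 : log 8 = 3 * log 2 := by
    rw [show (8 : ℝ) = 2 ^ 3 by norm_num, log_pow]
    norm_num
  have hdiv : ∀ n : ℕ, 2 * y ≤ n * log y → 2 * y / log y ≤ n := fun n h => by
    rwa [div_le_iff₀ hlogpos]
  rcases lt_or_ge g 14 with h14 | h14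
  · refine ⟨3, 6, by norm_num, by norm_num, by norm_num, by omega, hdiv 6 ?_⟩
    have hg' : (g : ℝ) ≤ 13 := by exact_mod_cast (by omega : g ≤ 13)
    have h1 := log_tangent_le (c := 4) (by norm_num) hy0
    have hlo : 3.46 ≤ y := by rw [hy]; nlinarith
    have hhi : y ≤ 4.16 := by rw [hy]; nlinarith
    have h2 : y ≤ 3 * (2.386 - 4 / y) := by
      rw [mul_sub, le_sub_iff_add_le, ← mul_div_assoc, ← le_sub_iff_add_le', div_le_iff₀ hy0]
      nlinarith [mul_nonneg (sub_nonneg.mpr hlo) (sub_nonneg.mpr hhi)]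
    push_cast
    linarith
  rcases lt_or_ge g 26 with h26 | h26
  · refine ⟨3, 8, by norm_num, by norm_num, by norm_num, by omega, hdiv 8 ?_⟩
    have hg' : (g : ℝ) ≤ 25 := by exact_mod_cast (by omega : g ≤ 25)
    have hg'' : (14 : ℝ) ≤ g := by exact_mod_cast h14
    have h1 := log_tangent_le (c := 8) (by norm_num) hy0
    have hlo : 4.5 ≤ y := by rw [hy]; nlinarith
    have hhi : y ≤ 8.32 := by rw [hy]; nlinarith
    have h2 : y ≤ 4 * (3.079 - 8 / y) := by
      rw [mul_sub, le_sub_iff_add_le, ← mul_div_assoc, ← le_sub_iff_add_le', div_le_iff₀ hy0]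
      nlinarith [mul_nonneg (sub_nonneg.mpr hlo) (sub_nonneg.mpr hhi)]
    push_cast
    linarith
  rcases lt_or_ge g 29 with h29 | h29
  · refine ⟨4, 9, by norm_num, by norm_num, by norm_num, by omega, hdiv 9 ?_⟩
    have hg' : (g : ℝ) ≤ 28 := by exact_mod_cast (by omega : g ≤ 28)
    have hg'' : (26 : ℝ) ≤ g := by exact_mod_cast h26
    have h1 := log_tangent_le (c := 8) (by norm_num) hy0
    have hlo : 8.66 ≤ y := by rw [hy]; nlinarith
    have hhi : y ≤ 9.36 := by rw [hy]; nlinarith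
    have h2 : 2 * y ≤ 9 * (3.079 - 8 / y) := by
      rw [mul_sub, le_sub_iff_add_le, ← mul_div_assoc, ← le_sub_iff_add_le', div_le_iff₀ hy0]
      nlinarith [mul_nonneg (sub_nonneg.mpr hlo) (sub_nonneg.mpr hhi)]
    push_cast
    linarith
  · have hg'' : (29 : ℝ) ≤ g := by exact_mod_cast h29
    have hlo : 9.7 ≤ y := by rw [hy]; nlinarith
    -- `y ^ 4 ≥ 2 ^ 13`
    have hL : 2.25 ≤ log y := by
      have h1 : log ((2 : ℝ) ^ 13) ≤ log (y ^ 4) := by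
        refine log_le_log (by positivity) ?_
        calc (2 : ℝ) ^ 13 ≤ 9.7 ^ 4 := by norm_num
          _ ≤ y ^ 4 := by gcongr
      rw [log_pow, log_pow] at h1
      push_cast at h1
      linarith
    have hq : 2 * y / log y ≤ 2 * y / 2.25 := by gcongr
    have hn0 : 1 < 2 * y / log y := by
      rw [lt_div_iff₀ hlogpos]
      linarith [log_le_sub_one_of_pos hy0]
    set n := ⌈2 * y / log y⌉₊ with hn
    have hn1 : 2 * y / log y ≤ n := Nat.le_ceil _
    have hn2 : (n : ℝ) < 2 * y / log y + 1 := Nat.ceil_lt_add_one (by linarith)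
    have hn3 : (n : ℝ) ≤ y := by
      have : 2 * y / 2.25 + 1 ≤ y := by
        rw [← le_sub_iff_add_le, div_le_iff₀ (by norm_num)]
        linarith
      linarith
    have hn4 : 1 < n := by exact_mod_cast hn0.trans_le hn1
    have hm0 : 0 < Nat.clog 2 n := Nat.clog_pos (by norm_num) hn4
    refine ⟨Nat.clog 2 n, n, hm0, hn4.le, Nat.le_pow_clog (by norm_num) n, ?_, hn1⟩
    have hm1 : 2 ^ (Nat.clog 2 n - 1) < n := Nat.pow_pred_clog_lt_self (by norm_num) hn4
    have hm2 : ((Nat.clog 2 n - 1 : ℕ) : ℝ) * log 2 ≤ log y := by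
      rw [← log_pow]
      refine log_le_log (by positivity) (le_trans ?_ hn3)
      exact_mod_cast hm1.le
    have hn5 : ((n - 1 : ℕ) : ℝ) ≤ 2 * y / log y := by
      rw [Nat.cast_sub hn4.le]
      push_cast
      linarith
    have h1 : ((Nat.clog 2 n - 1 : ℕ) : ℝ) * log 2 * ((n - 1 : ℕ) : ℝ) ≤ log 2 * (g - 1) := by
      calc _ ≤ log y * (2 * y / log y) := by gcongr
        _ = 2 * y := by field_simp
        _ = log 2 * (g - 1) := by rw [hy]; ring
    have h2 : (((Nat.clog 2 n - 1) * (n - 1) : ℕ) : ℝ) ≤ g := by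
      have h3 : log 2 * (((Nat.clog 2 n - 1) * (n - 1) : ℕ) : ℝ) ≤ log 2 * (g - 1) := by
        rw [Nat.cast_mul]
        linarith
      linarith [le_of_mul_le_mul_left h3 (by linarith)]
    exact_mod_cast h2

open Real in
lemma denominator_eq {g : ℕ} (hg : 11 ≤ g) :
    log ((g : ℝ) - 1) + log (log 2) - log 2 = log (log 2 * (g - 1) / 2) := by
  have hgR : (11 : ℝ) ≤ g := by exact_mod_cast hg
  have hl : 0 < log 2 := log_pos (by norm_num)
  rw [log_div (mul_pos hl (by linarith)).ne' (by norm_num), log_mul hl.ne' (by linarith)]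
  ring

open Real in
lemma lower_bound_le_chiO {g : ℕ} (hg : 11 ≤ g) :
    log 2 * ((g : ℝ) - 1) / (log ((g : ℝ) - 1) + log (log 2) - log 2) ≤
      ((chiO g).toNat : ℝ) := by
  obtain ⟨-, m, n, hm, hn, hnm, hmn, h⟩ := exists_bipartite_sizes hg rfl
  have h1 := le_chiO hm hn hnm hmn
  have h2 : n ≤ (chiO g).toNat := by
    rw [← ENat.natCast_toNat (chiO_mem (by omega)).2] at h1
    exact_mod_cast h1
  rw [denominator_eq hg]
  have h3 : (n : ℝ) ≤ ((chiO g).toNat : ℝ) := by exact_mod_cast h2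
  refine le_trans (le_of_eq ?_) (h.trans h3)
  congr 1
  ring

open Real in
lemma chiO_le_mul_log {g : ℕ} (hg : 11 ≤ g) :
    ((chiO g).toNat : ℝ) ≤ 2 ^ 40 * (g : ℝ) * log (g : ℝ) := by
  have h1 : (chiO g).toNat ≤ 2 ^ 40 * g := by
    have := chiO_le (g := g) (by omega)
    rw [← ENat.natCast_toNat (chiO_mem (g := g) (by omega)).2] at this
    exact_mod_cast this
  have h2 : ((chiO g).toNat : ℝ) ≤ 2 ^ 40 * (g : ℝ) := by exact_mod_cast h1
  have hgR : (11 : ℝ) ≤ g := by exact_mod_cast hg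
  have h3 : 1 ≤ log (g : ℝ) := by
    rw [le_log_iff_exp_le (by linarith)]
    linarith [exp_one_lt_d9]
  exact h2.trans (le_mul_of_one_le_right (by positivity) h3)

open Real in
lemma div_log_le_mul_chiO {g : ℕ} (hg : 11 ≤ g) :
    (g : ℝ) / log (g : ℝ) ≤ 2 / log 2 * ((chiO g).toNat : ℝ) := by
  have hgR : (11 : ℝ) ≤ g := by exact_mod_cast hg
  have hl : 0 < log 2 := log_pos (by norm_num)
  have hl1 : log 2 < 1 := by linarith [log_two_lt_d9]
  have h := lower_bound_le_chiO hg
  have hy := (exists_bipartite_sizes hg rfl).1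
  rw [denominator_eq hg] at h
  have h1 : log (log 2 * (g - 1) / 2) ≤ log (g : ℝ) := by
    refine log_le_log (by linarith) ?_
    nlinarith
  have h2 : log 2 * ((g : ℝ) - 1) / log g ≤ ((chiO g).toNat : ℝ) := by
    refine le_trans ?_ h
    refine div_le_div_of_nonneg_left ?_ (log_pos hy) h1
    exact mul_nonneg hl.le (by linarith)
  have hlg : 0 < log (g : ℝ) := log_pos (by linarith)
  calc (g : ℝ) / log g ≤ (2 * (g - 1)) / log g := by
        gcongr
        linarith
    _ = 2 / log 2 * (log 2 * ((g : ℝ) - 1) / log g) := by field_simp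
    _ ≤ _ := by gcongr

end OrientedGenus

theorem theorem1 :
    (∀ g : ℕ, 11 ≤ g →
      OrientedGenus.chiO g ∈ OrientedGenus.orientedChromaticNumbers g ∧
      OrientedGenus.chiO g ≠ ⊤ ∧
      Real.log 2 * ((g : ℝ) - 1) /
          (Real.log ((g : ℝ) - 1) + Real.log (Real.log 2) - Real.log 2)
        ≤ ((OrientedGenus.chiO g).toNat : ℝ) ∧
      ((OrientedGenus.chiO g).toNat : ℝ) ≤ 2 ^ 40 * (g : ℝ) * Real.log (g : ℝ)) ∧
    (fun g : ℕ => (g : ℝ) / Real.log (g : ℝ)) =O[Filter.atTop]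
      (fun g : ℕ => ((OrientedGenus.chiO g).toNat : ℝ)) ∧
    (fun g : ℕ => ((OrientedGenus.chiO g).toNat : ℝ)) =O[Filter.atTop]
      (fun g : ℕ => (g : ℝ) * Real.log (g : ℝ)) := by
  refine ⟨fun g hg => ?_, ?_, ?_⟩
  · obtain ⟨h1, h2⟩ := OrientedGenus.chiO_mem (g := g) (by omega)
    exact ⟨h1, h2, OrientedGenus.lower_bound_le_chiO hg, OrientedGenus.chiO_le_mul_log hg⟩
  · refine Asymptotics.IsBigO.of_bound (2 / Real.log 2) ?_
    filter_upwards [Filter.eventually_ge_atTop 11] with g hg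
    rw [Real.norm_of_nonneg (div_nonneg (by positivity) (Real.log_natCast_nonneg g)),
      Real.norm_of_nonneg (by positivity)]
    exact OrientedGenus.div_log_le_mul_chiO hg
  · refine Asymptotics.IsBigO.of_bound (2 ^ 40) ?_
    filter_upwards [Filter.eventually_ge_atTop 11] with g hg
    rw [Real.norm_of_nonneg (mul_nonneg (by positivity) (Real.log_natCast_nonneg g)),
      Real.norm_of_nonneg (by positivity), ← mul_assoc]
    exact OrientedGenus.chiO_le_mul_log hg
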